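/- For complex $p,x,y,z$ with $|p|>1$ put $$F_p(x,y,z)=\sum_{n=0}^\infty\frac{\prod_{k=1}^n(p^k-1)\cdot(-pz)^n}{\prod_{k=1}^n(p^k-x)(p^k-y)} \qquad (x,y\notin\{p,p^2,p^3,\dots\}),$$ $$\ell_p(x,z)=x\sum_{n=1}^\infty\frac{z^n}{p^n-x} \qquad (x\notin\{p,p^2,p^3,\dots\},\ |z|<|p|).$$ **Theorem 2.** Let $p,x,z$ be complex numbers with $|p|>1$, $x\ne0$, $x\notin\{1,p,p^2,\dots\}$ and $0<|z|<1$ (in particular, any $x,z$ with $0<|x|,|z|<1$ are allowed). Then the series defining $F_p(x,z,xz)$ and $\ell_p(px,pz)$ converge absolutely, and $$F_p(x,z,xz)=\frac{(1-x)(1-z)}{pxz}\,\ell_p(px,pz).$$ In particular, for an integer $p\ne0,\pm1$ and rational $x$ and $z$ such that $0<|x|<1$ and $0<|z|<1$, the value $F_p(x,z,xz)$ is irrational. -/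

import Mathlib

/-- The `n`-th term (`n = 0, 1, 2, …`) of the `q`-hypergeometric series `qHyp p x y z`:
`∏_{k=1}^n (p^k - 1) · (-p z)^n / ∏_{k=1}^n (p^k - x) (p^k - y)`. -/
def qHypTerm {K : Type*} [Field K] (p x y z : K) (n : ℕ) : K :=
  (∏ k ∈ Finset.Icc 1 n, (p ^ k - 1)) * (-p * z) ^ n /
    ∏ k ∈ Finset.Icc 1 n, ((p ^ k - x) * (p ^ k - y))

/-- The `q`-hypergeometric function `F_p(x, y, z)`. -/
noncomputable def qHyp {K : Type*} [Field K] [TopologicalSpace K] (p x y z : K) : K :=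
  ∑' n : ℕ, qHypTerm p x y z n

/-- The term `z^(n+1) / (p^(n+1) - x)` of the generalized `q`-logarithm; the series over
`1, 2, 3, …` is indexed from `n = 0`. -/
def genQLogTerm {K : Type*} [Field K] (p x z : K) (n : ℕ) : K :=
  z ^ (n + 1) / (p ^ (n + 1) - x)

/-- The generalized `q`-logarithm `ℓ_p(x, z) = x ∑_{n ≥ 1} z^n / (p^n - x)`. -/
noncomputable def genQLog {K : Type*} [Field K] [TopologicalSpace K] (p x z : K) : K :=
  x * ∑' n : ℕ, genQLogTerm p x z n

/-! Put q = 1/p and N_k(w) = ∏_{j<k} (w - q^j). The identity is a double-sum exchange. Newton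
interpolation of 1/(1 - xw) at the nodes q^j terminates at w = q^n, because N_k(q^n) = 0 for k > n.
Multiplying by z^n and summing over n first gives the closed form of `tsum_pow_mul_newtonPoly`,
hence the hypergeometric series; summing over k first gives ∑ z^n / (1 - x q^n), which is the
q-logarithm up to a factor (`hasSum_rapid`, `qHyp_identity`).

For irrationality, consider L(x, z) = ∑ x^m / (1 - z q^m) and the bilinear form `qPair`, whose
moments on monomials are L(x q^j, z q^i). Two functional equations express every moment rationally
through L(x, z). If L(x, z) were rational, multiplying row i and column j of the N × N moment matrix
by explicit integers would make it integral (`exists_int_moment`); these integers have total product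
at most C^(N²) |p|^(N³/3). In the Newton basis, which changes the determinant by a unitriangular
factor only, the entries are O(|q|^((i+j) choose 2)), so the determinant is at most |q|^(N³/2) up to
factors C^(N²) (`abs_det_moment_le`). Since 1/3 < 1/2, the resulting integer determinant has
absolute value below 1 for large N, so it must be 0.

It remains to show that the moment determinants do not vanish. The kernel expands as q^(nm) = ∑_k
c_k N_k(q^n) N_k(q^m) with c_k = 1 / N_k(q^k), so `qPair` is a sum of products of one-variable
functionals (`qPair_hasSum_newton`). Polynomials given by a q-Rodrigues formula are orthogonal to
N_k for k below their index, and for small x and z their rescaled Gram matrix is strictly diagonally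
dominant (`det_moment_ne_zero`). The functional equations reduce general x, z to x q^40, z q^40,
which are small enough. -/

section QSeries

open Polynomial Finset

/-! ### Newton polynomials at the nodes q^j -/

/-- The Newton polynomial `∏_{j<k} (X - q^j)`. -/
noncomputable def newtonPoly {K : Type*} [Field K] (q : K) (k : ℕ) : K[X] :=
  ∏ j ∈ range k, (X - C (q ^ j))

section Newton
variable {K : Type*} [Field K] {q : K}

theorem newtonPoly_eval (k : ℕ) (w : K) :
    (newtonPoly q k).eval w = ∏ j ∈ range k, (w - q ^ j) := by
  simp [newtonPoly, eval_prod]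

@[simp] theorem newtonPoly_zero : newtonPoly q 0 = 1 := by simp [newtonPoly]

theorem newtonPoly_succ (k : ℕ) : newtonPoly q (k + 1) = newtonPoly q k * (X - C (q ^ k)) := by
  simp [newtonPoly, prod_range_succ]

theorem newtonPoly_eval_succ (k : ℕ) (w : K) :
    (newtonPoly q (k + 1)).eval w = (newtonPoly q k).eval w * (w - q ^ k) := by
  simp [newtonPoly_succ]

theorem newtonPoly_eval_pow_eq_zero {n k : ℕ} (h : n < k) :
    (newtonPoly q k).eval (q ^ n) = 0 := by
  rw [newtonPoly_eval]
  exact prod_eq_zero (mem_range.2 h) (sub_self _)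

theorem newtonPoly_monic (k : ℕ) : (newtonPoly q k).Monic :=
  monic_prod_of_monic _ _ fun _ _ => monic_X_sub_C _

theorem newtonPoly_natDegree (k : ℕ) : (newtonPoly q k).natDegree = k := by
  rw [newtonPoly, natDegree_prod_of_monic _ _ fun _ _ => monic_X_sub_C _]
  simp only [natDegree_X_sub_C, sum_const, card_range, smul_eq_mul, mul_one]

/-- Dilating the argument of a Newton polynomial by `q`. -/
theorem newtonPoly_eval_mul_left (k : ℕ) (w : K) :
    (newtonPoly q (k + 1)).eval (q * w) = q ^ k * (q * w - 1) * (newtonPoly q k).eval w := by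
  rw [newtonPoly_eval, newtonPoly_eval, prod_range_succ']
  have : ∏ j ∈ range k, (q * w - q ^ (j + 1)) = q ^ k * ∏ j ∈ range k, (w - q ^ j) := by
    rw [← card_range k, ← prod_const, card_range, ← prod_mul_distrib]
    exact prod_congr rfl fun j _ => by ring
  rw [this]; ring

/-- Newton interpolation of `w ↦ 1 / (1 - x w)` at the nodes `q^j`, with remainder. -/
theorem inv_one_sub_eq_newton {x w : K} (hx : ∀ j : ℕ, 1 - x * q ^ j ≠ 0) (hw : 1 - x * w ≠ 0)
    (k : ℕ) : (1 - x * w)⁻¹ =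
      ∑ i ∈ range k, x ^ i * (newtonPoly q i).eval w / ∏ j ∈ range (i + 1), (1 - x * q ^ j) +
      x ^ k * (newtonPoly q k).eval w / ((∏ j ∈ range k, (1 - x * q ^ j)) * (1 - x * w)) := by
  induction k with
  | zero => simp
  | succ k ih =>
    have hp : ∏ j ∈ range k, (1 - x * q ^ j) ≠ 0 := prod_ne_zero_iff.2 fun j _ => hx j
    rw [ih, sum_range_succ, add_assoc, newtonPoly_eval_succ, prod_range_succ]
    congr 1
    have := hx k
    field_simp
    ring

theorem inv_one_sub_pow_eq_newton {x : K} (hx : ∀ j : ℕ, 1 - x * q ^ j ≠ 0) (n : ℕ) :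
    (1 - x * q ^ n)⁻¹ = ∑ i ∈ range (n + 1),
      x ^ i * (newtonPoly q i).eval (q ^ n) / ∏ j ∈ range (i + 1), (1 - x * q ^ j) := by
  rw [inv_one_sub_eq_newton hx (hx n) (n + 1), newtonPoly_eval_pow_eq_zero (Nat.lt_succ_self n)]
  simp

end Newton

/-! ### The hypergeometric identity over a complete normed field -/

section Identity
variable {K : Type*} [NormedField K]

theorem norm_newtonPoly_eval_le {q : K} (hq : ‖q‖ ≤ 1) (k n : ℕ) :
    ‖(newtonPoly q k).eval (q ^ n)‖ ≤ ∏ j ∈ range k, (2 * ‖q‖ ^ j) := by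
  rcases lt_or_ge n k with h | h
  · rw [newtonPoly_eval_pow_eq_zero h, norm_zero]
    positivity
  · rw [newtonPoly_eval, norm_prod]
    refine prod_le_prod (fun _ _ => norm_nonneg _) fun j hj => ?_
    have hj : j ≤ n := (mem_range.1 hj).le.trans h
    calc ‖q ^ n - q ^ j‖ ≤ ‖q ^ n‖ + ‖q ^ j‖ := norm_sub_le _ _
      _ ≤ ‖q‖ ^ j + ‖q‖ ^ j := by
        rw [norm_pow, norm_pow]
        gcongr ?_ + _
        exact pow_le_pow_of_le_one (norm_nonneg _) hq hj
      _ = _ := by ring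

theorem summable_pow_mul_prod {r : ℝ} (hr0 : 0 ≤ r) (hr : r < 1) {A : ℝ} (hA : 0 ≤ A) :
    Summable fun k : ℕ => ∏ j ∈ range k, (A * r ^ j) := by
  have ht : Filter.Tendsto (fun n : ℕ => A * r ^ n) Filter.atTop (nhds 0) := by
    simpa using (tendsto_pow_atTop_nhds_zero_of_lt_one hr0 hr).const_mul A
  refine summable_of_ratio_norm_eventually_le (r := 1 / 2) (by norm_num) ?_
  filter_upwards [ht.eventually (ge_mem_nhds (show (0 : ℝ) < 1 / 2 by norm_num))] with n hn
  rw [prod_range_succ, norm_mul, mul_comm]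
  gcongr
  rw [Real.norm_of_nonneg (by positivity)]
  exact hn

/-- The factors tend to 1 and none vanishes, so only finitely many have to be compared with 1/2. -/
theorem exists_pos_le_norm_one_sub {q x : K} (hq : ‖q‖ < 1) (hx : ∀ j : ℕ, 1 - x * q ^ j ≠ 0) :
    ∃ c : ℝ, 0 < c ∧ c ≤ 1 ∧ ∀ j : ℕ, c ≤ ‖1 - x * q ^ j‖ := by
  have ht : Filter.Tendsto (fun n : ℕ => ‖1 - x * q ^ n‖) Filter.atTop (nhds 1) := by
    have := ((tendsto_pow_atTop_nhds_zero_of_norm_lt_one hq).const_mul x).const_sub 1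
    simpa using this.norm
  obtain ⟨n, hn⟩ := Filter.eventually_atTop.1
    (ht.eventually (le_mem_nhds (show (1 / 2 : ℝ) < 1 by norm_num)))
  obtain ⟨m, -, hm⟩ := exists_min_image (range (n + 1)) (fun j => ‖1 - x * q ^ j‖) ⟨0, by simp⟩
  refine ⟨min (1 / 2) ‖1 - x * q ^ m‖, lt_min (by norm_num) (norm_pos_iff.2 (hx m)),
    (min_le_left _ _).trans (by norm_num), fun j => ?_⟩
  rcases lt_or_ge j n with h | h
  · exact (min_le_right _ _).trans (hm j (mem_range.2 (by omega)))
  · exact (min_le_left _ _).trans (hn j h)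

variable [CompleteSpace K]

theorem summable_pow_mul_newtonPoly {q z : K} (hq : ‖q‖ ≤ 1) (hz : ‖z‖ < 1) (k : ℕ) :
    Summable fun n : ℕ => z ^ n * (newtonPoly q k).eval (q ^ n) := by
  refine Summable.of_norm_bounded
    (g := fun n => ‖z‖ ^ n * ∏ j ∈ range k, (2 * ‖q‖ ^ j))
    ((summable_geometric_of_lt_one (norm_nonneg _) hz).mul_right _) fun n => ?_
  rw [norm_mul, norm_pow]
  gcongr
  exact norm_newtonPoly_eval_le hq k n

/-- Since z^n q^n = (zq)^n, the last factor q^n - q^k of N_{k+1}(q^n) turns the sum into a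
difference of the case k at zq and at z. This is why z is quantified inside the induction. -/
theorem tsum_pow_mul_newtonPoly {q : K} (hq : ‖q‖ < 1) (k : ℕ) : ∀ {z : K}, ‖z‖ < 1 →
    ∑' n : ℕ, z ^ n * (newtonPoly q k).eval (q ^ n) =
      (∏ j ∈ range k, (-q ^ j * (1 - q ^ (j + 1)))) * z ^ k /
        ∏ j ∈ range (k + 1), (1 - z * q ^ j) := by
  induction k with
  | zero => intro z hz; simp [tsum_geometric_of_norm_lt_one hz]
  | succ k ih =>
    intro z hz
    have hzq : ‖z * q‖ < 1 := by
      rw [norm_mul]; nlinarith [norm_nonneg z, norm_nonneg q]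
    have hne : ∀ j : ℕ, 1 - z * q ^ j ≠ 0 := fun j h => by
      have : ‖z * q ^ j‖ < 1 := by
        rw [norm_mul, norm_pow]
        calc ‖z‖ * ‖q‖ ^ j ≤ ‖z‖ * 1 := by gcongr; exact pow_le_one₀ (norm_nonneg _) hq.le
          _ < 1 := by simpa
      rw [← sub_eq_zero.1 h, norm_one] at this
      exact this.false
    have h1 : ∀ n : ℕ, z ^ n * (newtonPoly q (k + 1)).eval (q ^ n) =
        (z * q) ^ n * (newtonPoly q k).eval (q ^ n) -
          q ^ k * (z ^ n * (newtonPoly q k).eval (q ^ n)) := fun n => by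
      rw [newtonPoly_eval_succ, mul_pow]; ring
    rw [tsum_congr h1, Summable.tsum_sub (summable_pow_mul_newtonPoly hq.le hzq k)
      ((summable_pow_mul_newtonPoly hq.le hz k).mul_left _), tsum_mul_left, ih hz, ih hzq]
    have e1 : ∏ j ∈ range (k + 1), (1 - z * q * q ^ j) =
        (∏ j ∈ range k, (1 - z * q ^ (j + 1))) * (1 - z * q ^ (k + 1)) := by
      rw [prod_range_succ]
      congr 1
      · exact prod_congr rfl fun j _ => by ring
      · ring
    have e2 : ∏ j ∈ range (k + 1), (1 - z * q ^ j) =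
        (∏ j ∈ range k, (1 - z * q ^ (j + 1))) * (1 - z) := by
      rw [prod_range_succ']; simp
    rw [prod_range_succ (fun j => 1 - z * q ^ j) (k + 1), e1, e2, prod_range_succ]
    have h2 : ∏ j ∈ range k, (1 - z * q ^ (j + 1)) ≠ 0 := prod_ne_zero_iff.2 fun j _ => hne _
    have h3 := hne (k + 1)
    have h4 : 1 - z ≠ 0 := by simpa using hne 0
    field_simp
    ring

/-- The bound ∏_{j<k} 2|q|^j on N_k(q^n) decays faster than any geometric sequence in k, which beats
the c^(-k-1) coming from the denominators. -/
theorem summable_newton_double {q x z : K} (hq : ‖q‖ < 1) (hx : ∀ j : ℕ, 1 - x * q ^ j ≠ 0)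
    (hz : ‖z‖ < 1) :
    Summable fun a : ℕ × ℕ => x ^ a.1 / (∏ j ∈ range (a.1 + 1), (1 - x * q ^ j)) *
      (z ^ a.2 * (newtonPoly q a.1).eval (q ^ a.2)) := by
  obtain ⟨c, hc0, hc1, hc⟩ := exists_pos_le_norm_one_sub hq hx
  refine Summable.of_norm_bounded
    (g := fun a : ℕ × ℕ => (c⁻¹ * ∏ j ∈ range a.1, (2 * ‖x‖ / c * ‖q‖ ^ j)) * ‖z‖ ^ a.2)
    (Summable.mul_of_nonneg
      ((summable_pow_mul_prod (norm_nonneg _) hq (by positivity)).mul_left _)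
      (summable_geometric_of_lt_one (norm_nonneg _) hz)
      (fun _ => by positivity) fun _ => by positivity) ?_
  rintro ⟨k, n⟩
  simp only [norm_mul, norm_div, norm_pow, norm_prod]
  have h1 : c ^ (k + 1) ≤ ∏ j ∈ range (k + 1), ‖1 - x * q ^ j‖ := by
    rw [← card_range (k + 1), ← prod_const, card_range]
    exact prod_le_prod (fun _ _ => hc0.le) fun j _ => hc j
  calc ‖x‖ ^ k / (∏ j ∈ range (k + 1), ‖1 - x * q ^ j‖) *
        (‖z‖ ^ n * ‖(newtonPoly q k).eval (q ^ n)‖)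
      ≤ ‖x‖ ^ k / c ^ (k + 1) * (‖z‖ ^ n * ∏ j ∈ range k, (2 * ‖q‖ ^ j)) := by
        gcongr
        exact norm_newtonPoly_eval_le hq.le k n
    _ = _ := by
        have : ∀ j : ℕ, 2 * ‖x‖ / c * ‖q‖ ^ j = ‖x‖ / c * (2 * ‖q‖ ^ j) := fun j => by ring
        simp_rw [this]
        rw [prod_mul_distrib (f := fun _ => ‖x‖ / c), prod_const, card_range, div_pow, pow_succ]
        generalize ∏ j ∈ range k, (2 * ‖q‖ ^ j) = t
        field_simp

/-- A transformation of the series `∑ z^n / (1 - x q^n)` into a rapidly convergent series. -/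
theorem hasSum_rapid {q x z : K} (hq : ‖q‖ < 1) (hx : ∀ j : ℕ, 1 - x * q ^ j ≠ 0)
    (hz : ‖z‖ < 1) :
    (Summable fun n : ℕ => z ^ n * (1 - x * q ^ n)⁻¹) ∧
    HasSum (fun k : ℕ => (∏ j ∈ range k, (-q ^ j * (1 - q ^ (j + 1)))) * (x * z) ^ k /
      ((∏ j ∈ range (k + 1), (1 - x * q ^ j)) * ∏ j ∈ range (k + 1), (1 - z * q ^ j)))
      (∑' n : ℕ, z ^ n * (1 - x * q ^ n)⁻¹) := by
  have hsum := summable_newton_double hq hx hz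
  set F : ℕ × ℕ → K := fun a => x ^ a.1 / (∏ j ∈ range (a.1 + 1), (1 - x * q ^ j)) *
    (z ^ a.2 * (newtonPoly q a.1).eval (q ^ a.2)) with hF
  have hrow : ∀ n : ℕ, HasSum (fun k => F (k, n)) (z ^ n * (1 - x * q ^ n)⁻¹) := fun n => by
    -- For fixed n only k ≤ n contributes, so the inner sum is the finite Newton expansion.
    have h0 : ∀ k ∉ range (n + 1), F (k, n) = 0 := fun k hk => by
      simp only [hF]
      rw [newtonPoly_eval_pow_eq_zero (by simpa [Nat.lt_succ_iff] using hk)]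
      simp
    have h1 : HasSum (fun k => F (k, n)) (∑ k ∈ range (n + 1), F (k, n)) :=
      hasSum_sum_of_ne_finset_zero h0
    have h2 : ∑ k ∈ range (n + 1), F (k, n) = z ^ n * (1 - x * q ^ n)⁻¹ := by
      rw [inv_one_sub_pow_eq_newton hx n, mul_sum]
      exact sum_congr rfl fun k _ => by simp only [hF]; ring
    rwa [h2] at h1
  have hswap : Summable (fun a : ℕ × ℕ => F a.swap) := hsum.prod_symm
  have hs1 : HasSum (fun n : ℕ => z ^ n * (1 - x * q ^ n)⁻¹) (∑' a : ℕ × ℕ, F a.swap) :=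
    hswap.hasSum.prod_fiberwise hrow
  refine ⟨hs1.summable, ?_⟩
  have hs2 : ∑' a : ℕ × ℕ, F a.swap = ∑' a, F a := (Equiv.prodComm ℕ ℕ).tsum_eq F
  rw [hs1.tsum_eq, hs2]
  refine hsum.hasSum.prod_fiberwise fun k => ?_
  have h1 := ((summable_pow_mul_newtonPoly hq.le hz k).hasSum).mul_left
    (x ^ k / ∏ j ∈ range (k + 1), (1 - x * q ^ j))
  rw [tsum_pow_mul_newtonPoly hq k hz, div_mul_div_comm, mul_left_comm, ← mul_pow] at h1
  exact h1

theorem qHyp_identity {p x z : K} (hp : 1 < ‖p‖) (hx0 : x ≠ 0) (hx : ∀ k : ℕ, x ≠ p ^ k)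
    (hz0 : z ≠ 0) (hz : ‖z‖ < 1) :
    Summable (qHypTerm p x z (x * z)) ∧ Summable (genQLogTerm p (p * x) (p * z)) ∧
    qHyp p x z (x * z) = (1 - x) * (1 - z) / (p * x * z) * genQLog p (p * x) (p * z) ∧
    qHyp p x z (x * z) = (1 - x) * (1 - z) * ∑' n : ℕ, z ^ n * (1 - x * p⁻¹ ^ n)⁻¹ := by
  have hp0 : p ≠ 0 := norm_pos_iff.1 (by linarith)
  have hq : ‖p⁻¹‖ < 1 := by rw [norm_inv]; exact inv_lt_one_of_one_lt₀ hp
  have key : ∀ y : K, ∀ j : ℕ, p ^ j - y = p ^ j * (1 - y * p⁻¹ ^ j) := fun y j => by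
    rw [inv_pow]; field_simp
  have hx' : ∀ j : ℕ, 1 - x * p⁻¹ ^ j ≠ 0 := fun j h => hx j (by
    have := key x j; rw [h, mul_zero, sub_eq_zero] at this; exact this.symm)
  have hz' : ∀ j : ℕ, 1 - z * p⁻¹ ^ j ≠ 0 := fun j h => by
    have h1 := key z j
    rw [h, mul_zero, sub_eq_zero] at h1
    rw [← h1, norm_pow] at hz
    exact absurd hz (not_lt.2 (one_le_pow₀ hp.le))
  obtain ⟨hs, hr⟩ := hasSum_rapid hq hx' hz
  have hterm : ∀ n : ℕ, qHypTerm p x z (x * z) n = (1 - x) * (1 - z) *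
      ((∏ j ∈ range n, (-p⁻¹ ^ j * (1 - p⁻¹ ^ (j + 1)))) * (x * z) ^ n /
      ((∏ j ∈ range (n + 1), (1 - x * p⁻¹ ^ j)) *
        ∏ j ∈ range (n + 1), (1 - z * p⁻¹ ^ j))) := fun n => by
    -- The products in `hasSum_rapid` start at j = 0, those of the hypergeometric term at k = 1; the
    -- extra factors are 1 - x and 1 - z.
    have e : ∀ y : K, ∏ j ∈ range (n + 1), (1 - y * p⁻¹ ^ j) =
        (∏ j ∈ range n, (1 - y * p⁻¹ ^ (j + 1))) * (1 - y) := fun y => by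
      rw [prod_range_succ']; simp
    have hx1 : 1 - x ≠ 0 := by simpa using hx' 0
    have hz1 : 1 - z ≠ 0 := by simpa using hz' 0
    have hX : ∏ j ∈ range n, (1 - x * p⁻¹ ^ (j + 1)) ≠ 0 := prod_ne_zero_iff.2 fun j _ => hx' _
    have hZ : ∏ j ∈ range n, (1 - z * p⁻¹ ^ (j + 1)) ≠ 0 := prod_ne_zero_iff.2 fun j _ => hz' _
    have ei : ∀ g : ℕ → K, ∏ k ∈ Icc 1 n, g k = ∏ j ∈ range n, g (j + 1) := fun g => by
      rw [range_eq_Ico, prod_Ico_add' g 0 n 1]; rfl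
    rw [qHypTerm, ei, ei, e, e]
    -- Comparison of successive ratios: the powers of p in the new factor combine to p^(m+1) · p /
    -- p^(2(m+1)) = p^(-m).
    have e3 : ∀ m : ℕ, (∏ j ∈ range m, (p ^ (j + 1) - 1)) * (-p * (x * z)) ^ m /
        ∏ j ∈ range m, ((p ^ (j + 1) - x) * (p ^ (j + 1) - z)) =
        (∏ j ∈ range m, (-p⁻¹ ^ j * (1 - p⁻¹ ^ (j + 1)))) * (x * z) ^ m /
        ((∏ j ∈ range m, (1 - x * p⁻¹ ^ (j + 1))) *
          ∏ j ∈ range m, (1 - z * p⁻¹ ^ (j + 1))) := fun m => by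
      induction m with
      | zero => simp
      | succ m ih =>
        have hX : 1 - x * p⁻¹ ^ (m + 1) ≠ 0 := hx' _
        have hZ : 1 - z * p⁻¹ ^ (m + 1) ≠ 0 := hz' _
        have hpm : (p : K) ^ (m + 1) ≠ 0 := pow_ne_zero _ hp0
        simp only [prod_range_succ, pow_succ (-p * (x * z)) m, pow_succ (x * z) m]
        rw [mul_mul_mul_comm, mul_div_mul_comm, ih, mul_mul_mul_comm (∏ _ ∈ range m, _),
          mul_mul_mul_comm (∏ j ∈ range m, (1 - x * p⁻¹ ^ (j + 1))), mul_div_mul_comm]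
        rw [key x, key z]
        have h1 : p ^ (m + 1) - 1 = p ^ (m + 1) * (1 - p⁻¹ ^ (m + 1)) := by
          simpa using key 1 (m + 1)
        rw [h1]
        have h2 : p⁻¹ ^ m = p / p ^ (m + 1) := by rw [inv_pow, pow_succ]; field_simp
        rw [h2]
        generalize p⁻¹ ^ (m + 1) = t at *
        field_simp
    rw [e3]
    field_simp
  have hlog : ∀ n : ℕ, genQLogTerm p (p * x) (p * z) n = z * (z ^ n * (1 - x * p⁻¹ ^ n)⁻¹) :=
    fun n => by
      have h1 := hx' n
      have h2 : p ^ (n + 1) - p * x = p * (p ^ n * (1 - x * p⁻¹ ^ n)) := by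
        rw [← key, pow_succ]; ring
      rw [genQLogTerm, h2, mul_pow, pow_succ p, pow_succ z]
      generalize 1 - x * p⁻¹ ^ n = t at *
      field_simp
  have hval : qHyp p x z (x * z) =
      (1 - x) * (1 - z) * ∑' n : ℕ, z ^ n * (1 - x * p⁻¹ ^ n)⁻¹ := by
    rw [qHyp, tsum_congr hterm, tsum_mul_left, hr.tsum_eq]
  refine ⟨?_, ?_, ?_, hval⟩
  · rw [show qHypTerm p x z (x * z) = _ from funext hterm]
    exact hr.summable.mul_left _
  · rw [show genQLogTerm p (p * x) (p * z) = _ from funext hlog]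
    exact hs.mul_left _
  · rw [hval, genQLog, tsum_congr hlog, tsum_mul_left]
    field_simp

end Identity

/-! ### The bilinear form and its moments -/

/-- The Lambert-type series `∑ x^m / (1 - z q^m)`. -/
noncomputable def lambertSum (q x z : ℝ) : ℝ := ∑' m : ℕ, x ^ m * (1 - z * q ^ m)⁻¹

/-- The bilinear form `∑ z^n x^m q^{nm} P(q^n) Q(q^m)` on polynomials. -/
noncomputable def qPair (q x z : ℝ) (P Q : ℝ[X]) : ℝ :=
  ∑' a : ℕ × ℕ, z ^ a.1 * x ^ a.2 * q ^ (a.1 * a.2) * P.eval (q ^ a.1) * Q.eval (q ^ a.2)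

section Pair
variable {q x z : ℝ}

theorem exists_abs_eval_pow_le (hq : |q| ≤ 1) (P : ℝ[X]) :
    ∃ C : ℝ, 0 ≤ C ∧ ∀ n : ℕ, |P.eval (q ^ n)| ≤ C := by
  refine ⟨∑ i ∈ range (P.natDegree + 1), |P.coeff i|, sum_nonneg fun _ _ => abs_nonneg _,
    fun n => ?_⟩
  rw [eval_eq_sum_range]
  refine (abs_sum_le_sum_abs _ _).trans (sum_le_sum fun i _ => ?_)
  rw [abs_mul, abs_pow, abs_pow]
  exact mul_le_of_le_one_right (abs_nonneg _)
    (pow_le_one₀ (by positivity) (pow_le_one₀ (abs_nonneg _) hq))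

theorem abs_lt_one_mul_pow (hq : |q| ≤ 1) (hx : |x| < 1) (j : ℕ) : |x * q ^ j| < 1 := by
  rw [abs_mul, abs_pow]
  exact (mul_le_of_le_one_right (abs_nonneg _) (pow_le_one₀ (abs_nonneg _) hq)).trans_lt hx

theorem one_sub_ne_zero_of_abs_lt_one (hx : |x| < 1) : 1 - x ≠ 0 := by
  have := (abs_lt.1 hx).2
  linarith

theorem summable_qPair (hq : |q| ≤ 1) (hx : |x| < 1) (hz : |z| < 1) (P Q : ℝ[X]) :
    Summable fun a : ℕ × ℕ =>
      z ^ a.1 * x ^ a.2 * q ^ (a.1 * a.2) * P.eval (q ^ a.1) * Q.eval (q ^ a.2) := by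
  obtain ⟨C, hC, hP⟩ := exists_abs_eval_pow_le hq P
  obtain ⟨D, hD, hQ⟩ := exists_abs_eval_pow_le hq Q
  refine Summable.of_norm_bounded (g := fun a : ℕ × ℕ => (|z| ^ a.1 * |x| ^ a.2) * (C * D))
    ((Summable.mul_of_nonneg (summable_geometric_of_lt_one (abs_nonneg _) hz)
      (summable_geometric_of_lt_one (abs_nonneg _) hx) (fun _ => by positivity)
      fun _ => by positivity).mul_right _) fun a => ?_
  rw [Real.norm_eq_abs]
  simp only [abs_mul, abs_pow]
  calc |z| ^ a.1 * |x| ^ a.2 * |q| ^ (a.1 * a.2) * |P.eval (q ^ a.1)| * |Q.eval (q ^ a.2)|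
      ≤ |z| ^ a.1 * |x| ^ a.2 * 1 * C * D := by
        gcongr
        · exact pow_le_one₀ (abs_nonneg _) hq
        · exact hP _
        · exact hQ _
    _ = _ := by ring

theorem qPair_eq_sum_coeff (hq : |q| ≤ 1) (hx : |x| < 1) (hz : |z| < 1) {P Q : ℝ[X]} {N : ℕ}
    (hP : P.natDegree < N) (hQ : Q.natDegree < N) :
    qPair q x z P Q = ∑ r ∈ range N, ∑ s ∈ range N,
      P.coeff r * qPair q x z (X ^ r) (X ^ s) * Q.coeff s := by
  have h : ∀ a : ℕ × ℕ,
      z ^ a.1 * x ^ a.2 * q ^ (a.1 * a.2) * P.eval (q ^ a.1) * Q.eval (q ^ a.2) =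
      ∑ r ∈ range N, ∑ s ∈ range N, P.coeff r * (z ^ a.1 * x ^ a.2 * q ^ (a.1 * a.2) *
        (X ^ r : ℝ[X]).eval (q ^ a.1) * (X ^ s : ℝ[X]).eval (q ^ a.2)) * Q.coeff s := fun a => by
    rw [eval_eq_sum_range' hP, eval_eq_sum_range' hQ, mul_assoc, sum_mul_sum, mul_sum]
    refine sum_congr rfl fun r _ => ?_
    rw [mul_sum]
    refine sum_congr rfl fun s _ => ?_
    simp only [eval_pow, eval_X]
    ring
  have hs : ∀ r s : ℕ, Summable fun a : ℕ × ℕ => P.coeff r * (z ^ a.1 * x ^ a.2 *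
      q ^ (a.1 * a.2) * (X ^ r : ℝ[X]).eval (q ^ a.1) * (X ^ s : ℝ[X]).eval (q ^ a.2)) *
      Q.coeff s := fun r s => ((summable_qPair hq hx hz (X ^ r) (X ^ s)).mul_left _).mul_right _
  rw [qPair, tsum_congr h, Summable.tsum_finsetSum fun r _ => summable_sum fun s _ => hs r s]
  refine sum_congr rfl fun r _ => ?_
  rw [Summable.tsum_finsetSum fun s _ => hs r s]
  refine sum_congr rfl fun s _ => ?_
  rw [tsum_mul_right, tsum_mul_left, qPair]

/-- The Gram matrix of `qPair` for two polynomial sequences, in terms of its moments. -/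
theorem qPair_matrix_eq (hq : |q| ≤ 1) (hx : |x| < 1) (hz : |z| < 1) {P Q : ℕ → ℝ[X]}
    (hP : ∀ i, (P i).natDegree ≤ i) (hQ : ∀ i, (Q i).natDegree ≤ i) (N : ℕ) :
    (Matrix.of fun i j : Fin N => qPair q x z (P i) (Q j)) =
      (Matrix.of fun i r : Fin N => (P i).coeff r) *
      (Matrix.of fun r s : Fin N => qPair q x z (X ^ (r : ℕ)) (X ^ (s : ℕ))) *
      (Matrix.of fun j s : Fin N => (Q j).coeff s).transpose := by
  ext i j
  simp only [Matrix.mul_apply, Matrix.of_apply, Matrix.transpose_apply]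
  rw [qPair_eq_sum_coeff hq hx hz ((hP i).trans_lt i.2) ((hQ j).trans_lt j.2), sum_comm,
    ← Fin.sum_univ_eq_sum_range]
  refine sum_congr rfl fun s _ => ?_
  rw [← Fin.sum_univ_eq_sum_range
    (fun r => (P i).coeff r * qPair q x z (X ^ r) (X ^ (s : ℕ)) * (Q j).coeff s), sum_mul]

/-- For fixed m the sum over n is geometric with ratio z q^i q^m. -/
theorem qPair_X_pow (hq : |q| ≤ 1) (hx : |x| < 1) (hz : |z| < 1) (i j : ℕ) :
    qPair q x z (X ^ i) (X ^ j) = lambertSum q (x * q ^ j) (z * q ^ i) := by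
  have hs := summable_qPair hq hx hz (X ^ i) (X ^ j)
  rw [qPair, ← (Equiv.prodComm ℕ ℕ).tsum_eq, lambertSum]
  refine ((hs.prod_symm.hasSum).prod_fiberwise fun m => ?_).tsum_eq.symm
  have h := (hasSum_geometric_of_abs_lt_one
    (abs_lt_one_mul_pow hq (abs_lt_one_mul_pow hq hz i) m)).mul_left ((x * q ^ j) ^ m)
  refine h.congr_fun fun n => ?_
  simp only [Prod.fst_swap, Prod.snd_swap, eval_pow, eval_X]
  ring

theorem summable_lambertSum (hq : |q| ≤ 1) (hx : |x| < 1) (hz : |z| < 1) :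
    Summable fun m : ℕ => x ^ m * (1 - z * q ^ m)⁻¹ := by
  refine Summable.of_norm_bounded (g := fun m => |x| ^ m * (1 - |z|)⁻¹)
    ((summable_geometric_of_lt_one (abs_nonneg _) hx).mul_right _) fun m => ?_
  rw [Real.norm_eq_abs, abs_mul, abs_pow, abs_inv]
  have h1 : |z * q ^ m| ≤ |z| := by
    rw [abs_mul, abs_pow]
    exact mul_le_of_le_one_right (abs_nonneg _) (pow_le_one₀ (abs_nonneg _) hq)
  have h2 : 1 - |z| ≤ |1 - z * q ^ m| := by
    have := abs_sub_abs_le_abs_sub 1 (z * q ^ m)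
    rw [abs_one] at this
    linarith
  have : 0 < 1 - |z| := by linarith
  gcongr

/-- Index shift: the sum at zq is the sum at z without its first term, divided by x. -/
theorem lambertSum_mul_right (hq : |q| ≤ 1) (hx : |x| < 1) (hz : |z| < 1) :
    x * lambertSum q x (z * q) = lambertSum q x z - (1 - z)⁻¹ := by
  rw [lambertSum, lambertSum, (summable_lambertSum hq hx hz).tsum_eq_zero_add, ← tsum_mul_left]
  simp only [pow_zero, mul_one, one_mul, add_sub_cancel_left]
  exact tsum_congr fun m => by rw [pow_succ', pow_succ']; ring_nf

/-- Termwise, z q^m / (1 - z q^m) = 1 / (1 - z q^m) - 1, and the subtracted 1's sum to a geometric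
series in x. -/
theorem lambertSum_mul_left (hq : |q| ≤ 1) (hx : |x| < 1) (hz : |z| < 1) :
    z * lambertSum q (x * q) z = lambertSum q x z - (1 - x)⁻¹ := by
  rw [← tsum_geometric_of_abs_lt_one hx, lambertSum, lambertSum, ← Summable.tsum_sub
    (summable_lambertSum hq hx hz) (summable_geometric_of_abs_lt_one hx), ← tsum_mul_left]
  refine tsum_congr fun m => ?_
  have := one_sub_ne_zero_of_abs_lt_one (abs_lt_one_mul_pow hq hz m)
  rw [mul_pow]
  field_simp
  ring

end Pair

/-! ### Denominators of the moments -/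

section Arithmetic

/-- The common denominators of the moments of `qPair` in terms of that of the first one. -/
theorem exists_int_moment {p a b c d F : ℤ} (hp : 1 < |p|) (ha : a ≠ 0) (hb : b ≠ 0)
    (hc : c ≠ 0) (hd : d ≠ 0) (hab : |a| < |b|) (hcd : |c| < |d|)
    (hF : ∃ t : ℤ, F * lambertSum (p : ℝ)⁻¹ (a / b) (c / d) = t) (i j : ℕ) :
    ∃ t : ℤ, ((F * (a ^ i * ∏ m ∈ range i, (d * p ^ m - c)) : ℤ) : ℝ) *
      lambertSum (p : ℝ)⁻¹ (a / b * (p : ℝ)⁻¹ ^ j) (c / d * (p : ℝ)⁻¹ ^ i) *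
      ((c ^ j * ∏ n ∈ range j, (b * p ^ n - a) : ℤ) : ℝ) = t := by
  have hp0 : (p : ℝ) ≠ 0 := by
    intro h; have : p = 0 := by exact_mod_cast h
    subst this; simp at hp
  have hq : |(p : ℝ)⁻¹| ≤ 1 := by
    rw [abs_inv]
    exact inv_le_one_of_one_le₀ (by exact_mod_cast hp.le)
  have ha' : (a : ℝ) ≠ 0 := by exact_mod_cast ha
  have hb' : (b : ℝ) ≠ 0 := by exact_mod_cast hb
  have hc' : (c : ℝ) ≠ 0 := by exact_mod_cast hc
  have hd' : (d : ℝ) ≠ 0 := by exact_mod_cast hd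
  have hx : |(a / b : ℝ)| < 1 := by
    rw [abs_div, div_lt_one (abs_pos.2 hb')]; exact_mod_cast hab
  have hz : |(c / d : ℝ)| < 1 := by
    rw [abs_div, div_lt_one (abs_pos.2 hd')]; exact_mod_cast hcd
  induction j with
  | zero =>
    induction i with
    | zero => simpa using hF
    | succ i ih =>
      obtain ⟨t, ht⟩ := ih
      have hr := lambertSum_mul_right hq hx (abs_lt_one_mul_pow hq hz i)
      have hn := one_sub_ne_zero_of_abs_lt_one (abs_lt_one_mul_pow hq hz i)
      -- The functional equation divides by a/b and subtracts d p^i / (d p^i - c), so the new factor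
      -- a (d p^i - c) clears both denominators.
      refine ⟨b * (t * (d * p ^ i - c) -
        F * (a ^ i * ∏ m ∈ range i, (d * p ^ m - c)) * (d * p ^ i)), ?_⟩
      simp only [prod_range_succ, pow_succ, pow_zero, mul_one, prod_range_zero, Int.cast_one] at *
      push_cast at *
      rw [mul_assoc] at hr
      rw [← ht]
      set L := lambertSum (p : ℝ)⁻¹ (a / b) (c / d * ((p : ℝ)⁻¹ ^ i * (p : ℝ)⁻¹)) with hL
      set L0 := lambertSum (p : ℝ)⁻¹ (a / b) (c / d * (p : ℝ)⁻¹ ^ i)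
      have hne : (d * p ^ i - c : ℝ) ≠ 0 := by
        intro h
        apply hn
        rw [inv_pow]; field_simp; linear_combination h
      have hi : (1 - c / d * (p : ℝ)⁻¹ ^ i)⁻¹ = d * p ^ i / (d * p ^ i - c) := by
        rw [inv_pow] at hn ⊢; field_simp
      rw [hi] at hr
      have hr' : (a : ℝ) * L * (d * p ^ i - c) = b * (L0 * (d * p ^ i - c) - d * p ^ i) := by
        field_simp at hr
        linear_combination hr
      linear_combination (F * (a ^ i * ∏ m ∈ range i, (d * p ^ m - c : ℝ))) * hr'
  | succ j ih =>
    obtain ⟨t, ht⟩ := ih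
    have hr := lambertSum_mul_left hq (abs_lt_one_mul_pow hq hx j) (abs_lt_one_mul_pow hq hz i)
    have hn := one_sub_ne_zero_of_abs_lt_one (abs_lt_one_mul_pow hq hx j)
    -- Here the division is by c / (d p^i): only c enters the denominator, while d p^i stays in the
    -- numerator.
    refine ⟨d * p ^ i * (t * (b * p ^ j - a) -
      F * (a ^ i * ∏ m ∈ range i, (d * p ^ m - c)) * (c ^ j * ∏ n ∈ range j, (b * p ^ n - a)) *
        (b * p ^ j)), ?_⟩
    simp only [prod_range_succ, pow_succ] at *
    push_cast at *
    rw [mul_assoc (a / b : ℝ)] at hr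
    rw [← ht]
    set L := lambertSum (p : ℝ)⁻¹ (a / b * ((p : ℝ)⁻¹ ^ j * (p : ℝ)⁻¹)) (c / d * (p : ℝ)⁻¹ ^ i)
      with hL
    set L0 := lambertSum (p : ℝ)⁻¹ (a / b * (p : ℝ)⁻¹ ^ j) (c / d * (p : ℝ)⁻¹ ^ i)
    have hne : (b * p ^ j - a : ℝ) ≠ 0 := by
      intro h
      apply hn
      rw [inv_pow]; field_simp; linear_combination h
    have hi : (1 - a / b * (p : ℝ)⁻¹ ^ j)⁻¹ = b * p ^ j / (b * p ^ j - a) := by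
      rw [inv_pow] at hn ⊢; field_simp
    rw [hi, inv_pow] at hr
    have hr' : (c : ℝ) * L * (b * p ^ j - a) =
        d * p ^ i * (L0 * (b * p ^ j - a) - b * p ^ j) := by
      field_simp at hr
      linear_combination hr
    linear_combination (F * (a ^ i * ∏ m ∈ range i, (d * p ^ m - c : ℝ))) *
      (c ^ j * ∏ n ∈ range j, (b * p ^ n - a : ℝ)) * hr'

end Arithmetic

/-! ### Binomial coefficient bookkeeping -/

theorem two_mul_choose_two_add (s : ℕ) : 2 * s.choose 2 + s = s * s := by
  induction s with
  | zero => rfl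
  | succ s ih =>
    rw [Nat.choose_succ_succ' s 1, Nat.choose_one_right]
    nlinarith

theorem six_mul_choose_three_add (s : ℕ) : 6 * s.choose 3 + 3 * s ^ 2 = s ^ 3 + 2 * s := by
  induction s with
  | zero => rfl
  | succ s ih =>
    have := two_mul_choose_two_add s
    rw [Nat.choose_succ_succ' s 2]
    nlinarith

theorem choose_two_add (i j : ℕ) : (i + j).choose 2 = i.choose 2 + j.choose 2 + i * j := by
  have h1 := two_mul_choose_two_add (i + j)
  have h2 := two_mul_choose_two_add i
  have h3 := two_mul_choose_two_add j
  nlinarith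

/-- Twice the difference of the two sides is (s - N)(s - N - 1), a product of consecutive integers.
With s = i + j this replaces the quadratic exponent by an affine one, which splits into row and
column weights. -/
theorem mul_le_choose_two_add (N s : ℕ) : N * s ≤ s.choose 2 + (N + 1).choose 2 := by
  have h1 := two_mul_choose_two_add s
  have h2 := two_mul_choose_two_add (N + 1)
  zify at *
  have h3 : 0 ≤ ((s : ℤ) - N) * (s - N - 1) := by
    rcases le_or_gt s N with h | h
    · exact mul_nonneg_of_nonpos_of_nonpos (by zify at h; linarith) (by zify at h; linarith)
    · exact mul_nonneg (by zify at h; linarith) (by zify at h; linarith)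
  nlinarith

theorem sum_range_choose_two (N : ℕ) : ∑ i ∈ range N, i.choose 2 = N.choose 3 := by
  induction N with
  | zero => rfl
  | succ N ih => rw [sum_range_succ, ih, Nat.choose_succ_succ' N 2, add_comm]

theorem prod_range_pow_eq_choose_two {R : Type*} [CommMonoid R] (r : R) (k : ℕ) :
    ∏ j ∈ range k, r ^ j = r ^ k.choose 2 := by
  induction k with
  | zero => simp
  | succ k ih =>
    rw [prod_range_succ, ih, Nat.choose_succ_succ' k 1, Nat.choose_one_right, add_comm, pow_add]

/-! ### Upper bound for the moment determinant -/

section Bounds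
variable {q : ℝ}

theorem quarter_le_prod_one_sub_half_pow (i : ℕ) :
    1 / 4 ≤ ∏ j ∈ range i, (1 - (1 / 2 : ℝ) ^ (j + 1)) := by
  rcases i with _ | i
  · norm_num
  -- The bound 1/4 alone does not survive the induction; the extra term absorbs the next factor.
  · suffices h : 1 / 4 + (1 / 2 : ℝ) ^ (i + 2) ≤ ∏ j ∈ range (i + 1), (1 - (1 / 2 : ℝ) ^ (j + 1)) by
      have : (0 : ℝ) < (1 / 2) ^ (i + 2) := by positivity
      linarith
    induction i with
    | zero => norm_num
    | succ i ih =>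
      rw [prod_range_succ]
      have h0 : (1 / 2 : ℝ) ^ i ≤ 1 := pow_le_one₀ (by norm_num) (by norm_num)
      have h1 : (0 : ℝ) < (1 / 2) ^ i := by positivity
      simp only [pow_succ] at ih ⊢
      nlinarith

theorem abs_pow_le_half_pow (hq : |q| ≤ 1 / 2) (a j : ℕ) :
    |q ^ (a + 1 + j)| ≤ (1 / 2) ^ (j + 1) := by
  rw [abs_pow]
  calc |q| ^ (a + 1 + j) ≤ (1 / 2) ^ (a + 1 + j) := by gcongr
    _ ≤ (1 / 2) ^ (j + 1) := pow_le_pow_of_le_one (by norm_num) (by norm_num) (by omega)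

theorem quarter_le_abs_prod_one_sub (hq : |q| ≤ 1 / 2) (a i : ℕ) :
    1 / 4 ≤ |∏ j ∈ range i, (1 - q ^ (a + 1 + j))| := by
  rw [abs_prod]
  refine (quarter_le_prod_one_sub_half_pow i).trans (prod_le_prod (fun j _ => ?_) fun j _ => ?_)
  · rw [sub_nonneg]; exact pow_le_one₀ (by norm_num) (by norm_num)
  · have h1 := abs_pow_le_half_pow hq a j
    have h2 := abs_sub_abs_le_abs_sub 1 (q ^ (a + 1 + j))
    rw [abs_one] at h2
    linarith

theorem abs_prod_one_sub_le_four (hq : |q| ≤ 1 / 2) (a i : ℕ) :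
    |∏ j ∈ range i, (1 - q ^ (a + 1 + j))| ≤ 4 := by
  have h1 : |∏ j ∈ range i, (1 - q ^ (a + 1 + j))| ≤ ∏ j ∈ range i, (1 + (1 / 2 : ℝ) ^ (j + 1)) := by
    rw [abs_prod]
    refine prod_le_prod (fun j _ => abs_nonneg _) fun j _ => ?_
    have h1 := abs_pow_le_half_pow hq a j
    have h2 := abs_sub 1 (q ^ (a + 1 + j))
    rw [abs_one] at h2
    linarith
  -- The upper bound follows from the lower one, as (1 + t)(1 - t) ≤ 1.
  have h2 : (∏ j ∈ range i, (1 + (1 / 2 : ℝ) ^ (j + 1))) *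
      ∏ j ∈ range i, (1 - (1 / 2 : ℝ) ^ (j + 1)) ≤ 1 := by
    rw [← prod_mul_distrib]
    refine prod_le_one (fun j _ => ?_) fun j _ => ?_
    · have : (1 / 2 : ℝ) ^ (j + 1) ≤ 1 := pow_le_one₀ (by norm_num) (by norm_num)
      have : (0 : ℝ) < (1 / 2 : ℝ) ^ (j + 1) := by positivity
      nlinarith
    · nlinarith [sq_nonneg ((1 / 2 : ℝ) ^ (j + 1))]
  have h3 := quarter_le_prod_one_sub_half_pow i
  have h4 : 0 ≤ ∏ j ∈ range i, (1 + (1 / 2 : ℝ) ^ (j + 1)) := by positivity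
  nlinarith

theorem newtonPoly_eval_pow_add (k d : ℕ) :
    (newtonPoly q k).eval (q ^ (k + d)) =
      (-1) ^ k * q ^ k.choose 2 * ∏ j ∈ range k, (1 - q ^ (d + 1 + j)) := by
  rw [newtonPoly_eval, ← prod_range_pow_eq_choose_two, ← prod_range_reflect (fun j => 1 - q ^ (d + 1 + j)),
    ← card_range k, ← prod_const, card_range, ← prod_mul_distrib, ← prod_mul_distrib]
  refine prod_congr rfl fun j hj => ?_
  have : j < k := mem_range.1 hj
  have h1 : k + d = j + (d + 1 + (k - 1 - j)) := by omega
  rw [h1, pow_add]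
  ring

theorem abs_newtonPoly_eval_le (hq : |q| ≤ 1 / 2) (k n : ℕ) :
    |(newtonPoly q k).eval (q ^ n)| ≤ 4 * |q| ^ k.choose 2 := by
  rcases lt_or_ge n k with h | h
  · rw [newtonPoly_eval_pow_eq_zero h, abs_zero]; positivity
  · obtain ⟨d, rfl⟩ := Nat.exists_eq_add_of_le h
    rw [newtonPoly_eval_pow_add, abs_mul, abs_mul, abs_pow, abs_neg, abs_one, one_pow, one_mul,
      abs_pow, mul_comm]
    gcongr
    exact abs_prod_one_sub_le_four hq d k

theorem hasSum_half_pow_mul (C : ℝ) :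
    HasSum (fun a : ℕ × ℕ => (1 / 2 : ℝ) ^ a.1 * (1 / 2) ^ a.2 * C) (4 * C) := by
  have h := (hasSum_geometric_two.mul hasSum_geometric_two
    (Summable.mul_of_nonneg summable_geometric_two summable_geometric_two
    (fun _ => by positivity) fun _ => by positivity)).mul_right C
  norm_num at h ⊢
  exact h

variable {x z : ℝ}

/-- Terms with n < i or m < j vanish, so q^(nm) contributes at least the exponent ij; together with
the exponents of N_i and N_j this gives (i + j) choose 2. -/
theorem abs_qPair_newtonPoly_le (hq : |q| ≤ 1 / 2) (hx : |x| ≤ 1 / 2) (hz : |z| ≤ 1 / 2) (i j : ℕ) :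
    |qPair q x z (newtonPoly q i) (newtonPoly q j)| ≤ 64 * |q| ^ (i + j).choose 2 := by
  have h := tsum_of_norm_bounded (hasSum_half_pow_mul (16 * |q| ^ (i + j).choose 2))
    (f := fun a : ℕ × ℕ => z ^ a.1 * x ^ a.2 * q ^ (a.1 * a.2) *
      (newtonPoly q i).eval (q ^ a.1) * (newtonPoly q j).eval (q ^ a.2)) fun a => by
    rw [Real.norm_eq_abs]
    rcases lt_or_ge a.1 i with h1 | h1
    · rw [newtonPoly_eval_pow_eq_zero h1, mul_zero, zero_mul, abs_zero]; positivity
    rcases lt_or_ge a.2 j with h2 | h2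
    · rw [newtonPoly_eval_pow_eq_zero h2, mul_zero, abs_zero]; positivity
    simp only [abs_mul, abs_pow]
    calc |z| ^ a.1 * |x| ^ a.2 * |q| ^ (a.1 * a.2) * |(newtonPoly q i).eval (q ^ a.1)| *
          |(newtonPoly q j).eval (q ^ a.2)|
        ≤ (1 / 2) ^ a.1 * (1 / 2) ^ a.2 * |q| ^ (i * j) * (4 * |q| ^ i.choose 2) *
          (4 * |q| ^ j.choose 2) := by
          gcongr ?_ ^ _ * ?_ ^ _ * ?_ * ?_ * ?_
          · exact pow_le_pow_of_le_one (abs_nonneg _) (by linarith) (Nat.mul_le_mul h1 h2)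
          · exact abs_newtonPoly_eval_le hq _ _
          · exact abs_newtonPoly_eval_le hq _ _
      _ = _ := by rw [choose_two_add, pow_add, pow_add]; ring
  rw [Real.norm_eq_abs] at h
  exact h.trans_eq (by ring)

/-- The weights are pulled out of rows and columns, leaving a matrix with entries at most C. -/
theorem abs_det_le_of_entry_le {N : ℕ} (A : Matrix (Fin N) (Fin N) ℝ) {C : ℝ} {r s : Fin N → ℝ}
    (hr : ∀ i, 0 < r i) (hs : ∀ i, 0 < s i) (h : ∀ i j, |A i j| ≤ r i * C * s j) :
    |A.det| ≤ (∏ i, r i) * (N.factorial * C ^ N) * ∏ j, s j := by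
  set B : Matrix (Fin N) (Fin N) ℝ := Matrix.of fun i j => (r i)⁻¹ * A i j * (s j)⁻¹ with hB
  have hA : A = Matrix.of fun i j => s j * (Matrix.of fun i j => r i * B i j) i j := by
    ext i j
    have := (hr i).ne'
    have := (hs j).ne'
    simp only [hB, Matrix.of_apply]
    field_simp
  have hBC : ∀ i j, |B i j| ≤ C := fun i j => by
    simp only [hB, Matrix.of_apply]
    rw [abs_mul, abs_mul, abs_inv, abs_inv, abs_of_pos (hr i), abs_of_pos (hs j),
      ← div_eq_mul_inv, div_le_iff₀ (hs j), inv_mul_le_iff₀ (hr i), ← mul_assoc]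
    exact h i j
  have hdet := Matrix.det_le (abv := AbsoluteValue.abs) (A := B) hBC
  rw [hA, Matrix.det_mul_row, Matrix.det_mul_column, abs_mul, abs_mul, abs_prod, abs_prod,
    prod_congr rfl fun i _ => abs_of_pos (hs i), prod_congr rfl fun i _ => abs_of_pos (hr i),
    mul_comm]
  simp only [Fintype.card_fin, nsmul_eq_mul, AbsoluteValue.abs_apply] at hdet
  have h1 : 0 < ∏ i, r i := prod_pos fun i _ => hr i
  have h2 : 0 < ∏ i, s i := prod_pos fun i _ => hs i
  gcongr

theorem det_coeff_newtonPoly (N : ℕ) :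
    (Matrix.of fun i r : Fin N => (newtonPoly q i).coeff r).det = 1 := by
  rw [Matrix.det_of_isLowerTriangular]
  · refine prod_eq_one fun i _ => ?_
    have := (newtonPoly_monic (q := q) i).coeff_natDegree
    rwa [newtonPoly_natDegree] at this
  · intro i j hij
    have hij' : (i : ℕ) < j := hij
    exact coeff_eq_zero_of_natDegree_lt ((newtonPoly_natDegree (q := q) i).trans_lt hij')

theorem abs_det_moment_le (hq0 : q ≠ 0) (hq : |q| ≤ 1 / 2) (hx : |x| ≤ 1 / 2) (hz : |z| ≤ 1 / 2)
    (N : ℕ) :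
    |(Matrix.of fun r s : Fin N => qPair q x z (X ^ (r : ℕ)) (X ^ (s : ℕ))).det| *
        |q| ^ (N * (N + 1).choose 2) ≤
      N.factorial * 64 ^ N * |q| ^ (2 * N * N.choose 2) := by
  have hq' : 0 < |q| := abs_pos.2 hq0
  have h := qPair_matrix_eq (q := q) (x := x) (z := z) (by linarith) (by linarith) (by linarith)
    (fun i => (newtonPoly_natDegree (q := q) i).le) (fun i => (newtonPoly_natDegree (q := q) i).le) N
  have h1 := congrArg Matrix.det h
  rw [Matrix.det_mul, Matrix.det_mul, Matrix.det_transpose, det_coeff_newtonPoly, one_mul,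
    mul_one] at h1
  rw [← h1]
  -- Weights |q|^(Ni) and |q|^(Nj) come from `mul_le_choose_two_add` with s = i + j.
  have h2 := abs_det_le_of_entry_le (Matrix.of fun i j : Fin N =>
    qPair q x z (newtonPoly q i) (newtonPoly q j)) (C := 64 / |q| ^ (N + 1).choose 2)
    (r := fun i => (|q| ^ N) ^ (i : ℕ)) (s := fun i => (|q| ^ N) ^ (i : ℕ))
    (fun i => by positivity) (fun i => by positivity) fun i j => by
      refine (abs_qPair_newtonPoly_le hq hx hz i j).trans ?_
      rw [mul_div_assoc', div_mul_eq_mul_div, le_div_iff₀ (by positivity)]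
      calc 64 * |q| ^ (i + j : ℕ).choose 2 * |q| ^ (N + 1).choose 2
          = 64 * |q| ^ ((i + j : ℕ).choose 2 + (N + 1).choose 2) := by rw [pow_add]; ring
        _ ≤ 64 * |q| ^ (N * (i + j)) := by
          gcongr ?_ * ?_
          exact pow_le_pow_of_le_one hq'.le (by linarith) (mul_le_choose_two_add _ _)
        _ = _ := by rw [mul_add, pow_add, pow_mul, pow_mul]; ring
  have h3 : ∏ i : Fin N, (|q| ^ N) ^ (i : ℕ) = |q| ^ (N * N.choose 2) := by
    rw [Fin.prod_univ_eq_prod_range (fun i => (|q| ^ N) ^ i), prod_range_pow_eq_choose_two,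
      pow_mul]
  rw [h3] at h2
  calc _ ≤ |q| ^ (N * N.choose 2) * (N.factorial * (64 / |q| ^ (N + 1).choose 2) ^ N) *
        |q| ^ (N * N.choose 2) * |q| ^ (N * (N + 1).choose 2) := by gcongr
    _ = _ := by
      rw [div_pow, ← pow_mul, mul_comm ((N + 1).choose 2)]
      field_simp
      ring

end Bounds

/-! ### An integer determinant that is too small -/

section Contradiction

theorem abs_prod_mul_pow_sub_le {p d c : ℤ} (hp : 1 ≤ |p|) (hcd : |c| ≤ |d|) (i : ℕ) :
    |((∏ m ∈ range i, (d * p ^ m - c) : ℤ) : ℝ)| ≤ (2 * |(d : ℝ)|) ^ i * |(p : ℝ)| ^ i.choose 2 := by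
  rw [← prod_range_pow_eq_choose_two, ← card_range i, ← prod_const, card_range, ← prod_mul_distrib,
    Int.cast_prod, abs_prod]
  refine prod_le_prod (fun _ _ => abs_nonneg _) fun m _ => ?_
  have hp' : (1 : ℝ) ≤ |(p : ℝ)| := by exact_mod_cast hp
  have hcd' : |(c : ℝ)| ≤ |(d : ℝ)| := by exact_mod_cast hcd
  push_cast
  calc |(d * p ^ m - c : ℝ)| ≤ |(d * p ^ m : ℝ)| + |(c : ℝ)| := abs_sub _ _
    _ ≤ |(d : ℝ)| * |(p : ℝ)| ^ m + |(d : ℝ)| * |(p : ℝ)| ^ m := by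
      rw [abs_mul, abs_pow]
      gcongr
      exact hcd'.trans (le_mul_of_one_le_right (abs_nonneg _) (one_le_pow₀ hp'))
    _ = _ := by ring

theorem abs_prod_scale_le {p a c d F : ℤ} (hp : 1 ≤ |p|) (hcd : |c| ≤ |d|) {B : ℝ} (hB : 1 ≤ B)
    (hFB : |(F : ℝ)| ≤ B) (hadB : |(a : ℝ)| * (2 * |(d : ℝ)|) ≤ B) (N : ℕ) :
    |∏ i : Fin N, ((F * (a ^ (i : ℕ) * ∏ m ∈ range i, (d * p ^ m - c)) : ℤ) : ℝ)| ≤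
      B ^ (N ^ 2) * |(p : ℝ)| ^ N.choose 3 := by
  rw [Fin.prod_univ_eq_prod_range
    (fun i => ((F * (a ^ i * ∏ m ∈ range i, (d * p ^ m - c)) : ℤ) : ℝ)), abs_prod,
    ← sum_range_choose_two, ← prod_pow_eq_pow_sum, pow_two, pow_mul]
  conv_rhs => rw [← card_range N, ← prod_const, card_range, ← prod_mul_distrib]
  refine prod_le_prod (fun _ _ => abs_nonneg _) fun i hi => ?_
  have h := abs_prod_mul_pow_sub_le hp hcd i
  rw [Int.cast_mul, Int.cast_mul, abs_mul, abs_mul, Int.cast_pow, abs_pow]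
  calc |(F : ℝ)| * (|(a : ℝ)| ^ i * |((∏ m ∈ range i, (d * p ^ m - c) : ℤ) : ℝ)|)
      ≤ B * (|(a : ℝ)| ^ i * ((2 * |(d : ℝ)|) ^ i * |(p : ℝ)| ^ i.choose 2)) := by gcongr
    _ = B * (|(a : ℝ)| * (2 * |(d : ℝ)|)) ^ i * |(p : ℝ)| ^ i.choose 2 := by
      rw [mul_pow]; ring
    _ ≤ B * B ^ i * |(p : ℝ)| ^ i.choose 2 := by gcongr
    _ ≤ B ^ N * |(p : ℝ)| ^ i.choose 2 := by
      rw [← pow_succ']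
      gcongr ?_ * _
      exact pow_le_pow_right₀ hB (mem_range.1 hi)

/-- If the moment determinants never vanish, the first moment is irrational. -/
theorem irrational_lambertSum_of_det_ne_zero {p a b c d : ℤ} (hp : 1 < |p|) (ha : a ≠ 0)
    (hb : b ≠ 0) (hc : c ≠ 0) (hd : d ≠ 0) (hab : |(a / b : ℝ)| ≤ 1 / 2)
    (hcd : |(c / d : ℝ)| ≤ 1 / 2)
    (hdet : ∀ N : ℕ, (Matrix.of fun r s : Fin N =>
      qPair (p : ℝ)⁻¹ (a / b) (c / d) (X ^ (r : ℕ)) (X ^ (s : ℕ))).det ≠ 0) :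
    Irrational (lambertSum (p : ℝ)⁻¹ (a / b) (c / d)) := by
  rintro ⟨t, ht⟩
  have hb' : (b : ℝ) ≠ 0 := by exact_mod_cast hb
  have hd' : (d : ℝ) ≠ 0 := by exact_mod_cast hd
  have hp2 : (2 : ℝ) ≤ |(p : ℝ)| := by exact_mod_cast hp
  have hP0 : 0 < |(p : ℝ)| := by linarith
  have hp0 : (p : ℝ) ≠ 0 := abs_pos.1 hP0
  have hq : |(p : ℝ)⁻¹| ≤ 1 / 2 := by
    rw [abs_inv, one_div]
    exact inv_anti₀ (by norm_num) hp2
  have habi : |a| < |b| := by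
    have : |(a / b : ℝ)| < 1 := by linarith
    rw [abs_div, div_lt_one (abs_pos.2 hb')] at this
    exact_mod_cast this
  have hcdi : |c| < |d| := by
    have : |(c / d : ℝ)| < 1 := by linarith
    rw [abs_div, div_lt_one (abs_pos.2 hd')] at this
    exact_mod_cast this
  set F : ℤ := (t.den : ℤ) with hF
  have hF0 : F ≠ 0 := by simp [hF]
  have hFt : ∃ u : ℤ, F * lambertSum (p : ℝ)⁻¹ (a / b) (c / d) = u := by
    refine ⟨t.num, ?_⟩
    rw [← ht, hF]
    have := Rat.den_mul_eq_num t
    exact_mod_cast this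
  have hone : ∀ u : ℤ, u ≠ 0 → (1 : ℝ) ≤ |(u : ℝ)| := fun u hu => by
    exact_mod_cast Int.one_le_abs hu
  have hfac : ∀ {u v : ℤ}, |v| < |u| → ∀ m : ℕ, u * p ^ m - v ≠ 0 := fun {u v} huv m h => by
    have h1 : |v| = |u| * |p| ^ m := by rw [← sub_eq_zero.1 h, abs_mul, abs_pow]
    have h2 : 1 ≤ |p| ^ m := one_le_pow₀ hp.le
    nlinarith [abs_nonneg u]
  -- One constant dominating |F|, 2|ad| and 2|bc|, so that it serves both rows and columns.
  set B : ℝ := |(F : ℝ)| * (2 * (|(a : ℝ)| * |(b : ℝ)| * |(c : ℝ)| * |(d : ℝ)|)) with hB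
  have hF1 := hone F hF0
  have ha1 := hone a ha
  have hb1 := hone b hb
  have hc1 := hone c hc
  have hd1 := hone d hd
  have hab1 := one_le_mul_of_one_le_of_one_le ha1 hb1
  have had1 := one_le_mul_of_one_le_of_one_le ha1 hd1
  have hbc1 := one_le_mul_of_one_le_of_one_le hb1 hc1
  have habcd1 := one_le_mul_of_one_le_of_one_le had1 hbc1
  have hB' : B = 2 * |(F : ℝ)| * ((|(a : ℝ)| * |(d : ℝ)|) * (|(b : ℝ)| * |(c : ℝ)|)) := by
    rw [hB]; ring
  have hFB : |(F : ℝ)| ≤ B := by nlinarith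
  have hB1 : 1 ≤ B := hF1.trans hFB
  have hadB : |(a : ℝ)| * (2 * |(d : ℝ)|) ≤ B := by
    have : |(a : ℝ)| * |(d : ℝ)| ≤ (|(a : ℝ)| * |(d : ℝ)|) * (|(b : ℝ)| * |(c : ℝ)|) :=
      le_mul_of_one_le_right (by linarith) hbc1
    nlinarith
  have hcbB : |(c : ℝ)| * (2 * |(b : ℝ)|) ≤ B := by
    have : |(b : ℝ)| * |(c : ℝ)| ≤ (|(a : ℝ)| * |(d : ℝ)|) * (|(b : ℝ)| * |(c : ℝ)|) :=
      le_mul_of_one_le_left (by linarith) had1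
    nlinarith
  clear_value B
  set P : ℝ := |(p : ℝ)| with hP
  have hbound : ∀ N : ℕ, 1 * P ^ (2 * N * N.choose 2) ≤
      (B ^ (N ^ 2) * P ^ N.choose 3) * (B ^ (N ^ 2) * P ^ N.choose 3) *
        (N.factorial * 64 ^ N * P ^ (N * (N + 1).choose 2)) := fun N => by
    choose u hu using fun i j : Fin N =>
      exists_int_moment hp ha hb hc hd habi hcdi hFt (i : ℕ) (j : ℕ)
    set M := Matrix.of fun r s : Fin N =>
      qPair (p : ℝ)⁻¹ (a / b) (c / d) (X ^ (r : ℕ)) (X ^ (s : ℕ)) with hM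
    set R : Fin N → ℤ := fun i => F * (a ^ (i : ℕ) * ∏ m ∈ range i, (d * p ^ m - c)) with hR
    set S : Fin N → ℤ := fun j => c ^ (j : ℕ) * ∏ n ∈ range j, (b * p ^ n - a) with hS
    have hRne : ∏ i, (R i : ℝ) ≠ 0 := prod_ne_zero_iff.2 fun i _ => by
      rw [Int.cast_ne_zero]
      exact mul_ne_zero hF0 (mul_ne_zero (pow_ne_zero _ ha)
        (prod_ne_zero_iff.2 fun m _ => hfac hcdi m))
    have hSne : ∏ i, (S i : ℝ) ≠ 0 := prod_ne_zero_iff.2 fun i _ => by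
      rw [Int.cast_ne_zero]
      exact mul_ne_zero (pow_ne_zero _ hc) (prod_ne_zero_iff.2 fun m _ => hfac habi m)
    have hU : ((Matrix.of u).det : ℝ) = (∏ j, (S j : ℝ)) * ((∏ i, (R i : ℝ)) * M.det) := by
      rw [← Matrix.det_mul_column, ← Matrix.det_mul_row, ← eq_intCast (Int.castRingHom ℝ),
        RingHom.map_det]
      congr 1
      ext i j
      rw [RingHom.mapMatrix_apply, Matrix.map_apply, Matrix.of_apply, eq_intCast, ← hu i j]
      simp only [Matrix.of_apply, hM]
      rw [qPair_X_pow (by linarith) (by linarith) (by linarith), mul_comm]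
    -- A nonzero integer has absolute value at least 1.
    have hU1 : 1 ≤ |(((Matrix.of u).det : ℤ) : ℝ)| := by
      apply hone
      intro h
      rw [h, Int.cast_zero] at hU
      exact mul_ne_zero hSne (mul_ne_zero hRne (hdet N)) hU.symm
    rw [hU, abs_mul, abs_mul] at hU1
    have hR1 := abs_prod_scale_le (F := F) hp.le hcdi.le hB1 hFB hadB N
    have hS1 := abs_prod_scale_le (F := 1) hp.le habi.le hB1 (by simpa using hB1) hcbB N
    simp only [one_mul] at hS1
    have hD := abs_det_moment_le (inv_ne_zero hp0) hq hab hcd N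
    rw [← hM, abs_inv, ← hP, inv_pow, inv_pow, ← div_eq_mul_inv, ← div_eq_mul_inv,
      div_le_div_iff₀ (by positivity) (by positivity)] at hD
    calc 1 * P ^ (2 * N * N.choose 2)
        ≤ |∏ j, (S j : ℝ)| * (|∏ i, (R i : ℝ)| * |M.det|) * P ^ (2 * N * N.choose 2) := by gcongr
      _ = |∏ j, (S j : ℝ)| * |∏ i, (R i : ℝ)| * (|M.det| * P ^ (2 * N * N.choose 2)) := by ring
      _ ≤ _ := by gcongr
  have hpow : ∀ N : ℕ, 1 ≤ N → P ^ N ≤ (128 * B ^ 2) ^ 6 * P ^ 7 := fun N hN => by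
    have h1 : P ^ (2 * N * N.choose 2) ≤
        (128 * B ^ 2) ^ (N ^ 2) * P ^ (2 * N.choose 3 + N * (N + 1).choose 2) := by
      refine (one_mul _).symm.le.trans ((hbound N).trans ?_)
      have hf : (N.factorial : ℝ) ≤ 2 ^ (N ^ 2) := by
        have : N.factorial ≤ 2 ^ (N ^ 2) := by
          rw [pow_two, pow_mul]
          exact (Nat.factorial_le_pow N).trans (Nat.pow_le_pow_left Nat.lt_two_pow_self.le N)
        exact_mod_cast this
      have h64 : (64 : ℝ) ^ N ≤ 64 ^ (N ^ 2) :=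
        pow_le_pow_right₀ (by norm_num) (Nat.le_self_pow (by norm_num) N)
      calc _ ≤ (B ^ (N ^ 2) * P ^ N.choose 3) * (B ^ (N ^ 2) * P ^ N.choose 3) *
            (2 ^ (N ^ 2) * 64 ^ (N ^ 2) * P ^ (N * (N + 1).choose 2)) := by gcongr
        _ = _ := by
          have e : (128 : ℝ) ^ (N ^ 2) = 2 ^ (N ^ 2) * 64 ^ (N ^ 2) := by
            rw [← mul_pow]; norm_num
          rw [mul_pow, e, pow_add, two_mul, pow_add]
          ring
    -- Sixth powers keep the exponents integral: the net gain in the exponent of P has leading term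
    -- N³/6.
    have h2 := pow_le_pow_left₀ (by positivity) h1 6
    rw [mul_pow, ← pow_mul, ← pow_mul, ← pow_mul] at h2
    have hexp : (2 * N.choose 3 + N * (N + 1).choose 2) * 6 + N ^ 3 ≤
        2 * N * N.choose 2 * 6 + 7 * N ^ 2 := by
      have e1 := six_mul_choose_three_add N
      have e2 := two_mul_choose_two_add N
      have e3 := two_mul_choose_two_add (N + 1)
      nlinarith
    have h3 : P ^ ((2 * N.choose 3 + N * (N + 1).choose 2) * 6) * P ^ N ^ 3 ≤
        (128 * B ^ 2) ^ (N ^ 2 * 6) * P ^ (7 * N ^ 2) *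
          P ^ ((2 * N.choose 3 + N * (N + 1).choose 2) * 6) := by
      calc _ = P ^ ((2 * N.choose 3 + N * (N + 1).choose 2) * 6 + N ^ 3) := by rw [pow_add]
        _ ≤ P ^ (2 * N * N.choose 2 * 6 + 7 * N ^ 2) := pow_le_pow_right₀ (by linarith) hexp
        _ = P ^ (2 * N * N.choose 2 * 6) * P ^ (7 * N ^ 2) := by rw [pow_add]
        _ ≤ (128 * B ^ 2) ^ (N ^ 2 * 6) * P ^ ((2 * N.choose 3 + N * (N + 1).choose 2) * 6) *
            P ^ (7 * N ^ 2) := by gcongr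
        _ = _ := by ring
    rw [mul_comm] at h3
    have h4 := le_of_mul_le_mul_right h3 (by positivity)
    have h5 : (P ^ N) ^ (N ^ 2) ≤ ((128 * B ^ 2) ^ 6 * P ^ 7) ^ (N ^ 2) := by
      rw [mul_pow, ← pow_mul, ← pow_mul, ← pow_mul, mul_comm 6, show N * N ^ 2 = N ^ 3 by ring]
      exact h4
    exact le_of_pow_le_pow_left₀ (by positivity) (by positivity) h5
  obtain ⟨N, hN⟩ := pow_unbounded_of_one_lt ((128 * B ^ 2) ^ 6 * P ^ 7) (show 1 < P by linarith)
  have h1 := hpow (N + 1) (by omega)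
  have h2 : P ^ N ≤ P ^ (N + 1) := pow_le_pow_right₀ (by linarith) (by omega)
  linarith

end Contradiction

/-! ### Orthogonal polynomials from a q-Rodrigues formula -/

/-- The functional `P ↦ ∑ z^n P(q^n)`. -/
noncomputable def qFunctional (q z : ℝ) (P : ℝ[X]) : ℝ := ∑' n : ℕ, z ^ n * P.eval (q ^ n)

/-- The backward difference `u(w) - u(w / q) / (q^m z)`, adjoint to `φ(w) ↦ φ(w) - φ(q w) / q^m`
for `qFunctional q z`. -/
noncomputable def qBackward (q z : ℝ) (m : ℕ) (u : ℝ[X]) : ℝ[X] :=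
  u - C (q ^ m * z)⁻¹ * u.comp (C q⁻¹ * X)

/-- The iterated backward difference of a Rodrigues formula. -/
noncomputable def qRodrigues (q z : ℝ) : ℕ → ℝ[X] → ℝ[X]
  | 0, u => u
  | i + 1, u => qRodrigues q z i (qBackward q z i u)

/-- The polynomial `∏_{j=1}^i (1 - q^j X)`. -/
noncomputable def qWeight (q : ℝ) (i : ℕ) : ℝ[X] := ∏ j ∈ range i, (1 - C (q ^ (j + 1)) * X)

/-- Orthogonal polynomials for `qFunctional q z`. -/
noncomputable def orthPoly (q z : ℝ) (i : ℕ) : ℝ[X] := qRodrigues q z i (qWeight q i)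

/-- The coefficients of the expansion of `q^{nm}` in products of Newton polynomials. -/
noncomputable def newtonCoeff (q : ℝ) (k : ℕ) : ℝ := ∏ r ∈ range k, (q ^ r * (q ^ (r + 1) - 1))⁻¹

section Rodrigues
variable {q z : ℝ}

theorem summable_qFunctional (hq : |q| ≤ 1) (hz : |z| < 1) (P : ℝ[X]) :
    Summable fun n : ℕ => z ^ n * P.eval (q ^ n) := by
  obtain ⟨C, hC, hP⟩ := exists_abs_eval_pow_le hq P
  refine Summable.of_norm_bounded (g := fun n => |z| ^ n * C)
    ((summable_geometric_of_lt_one (abs_nonneg _) hz).mul_right _) fun n => ?_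
  rw [Real.norm_eq_abs, abs_mul, abs_pow]
  gcongr
  exact hP n

theorem qBackward_eval (m : ℕ) (u : ℝ[X]) (w : ℝ) :
    (qBackward q z m u).eval w = u.eval w - (q ^ m * z)⁻¹ * u.eval (q⁻¹ * w) := by
  simp [qBackward, eval_comp]

theorem natDegree_qBackward_le (m : ℕ) (u : ℝ[X]) :
    (qBackward q z m u).natDegree ≤ u.natDegree := by
  refine (natDegree_sub_le _ _).trans (max_le le_rfl ?_)
  refine (natDegree_C_mul_le _ _).trans (natDegree_comp_le.trans ?_)
  exact (Nat.mul_le_mul_left _ ((natDegree_C_mul_le _ _).trans natDegree_X_le)).trans_eq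
    (mul_one _)

theorem natDegree_qRodrigues_le (i : ℕ) (u : ℝ[X]) :
    (qRodrigues q z i u).natDegree ≤ u.natDegree := by
  induction i generalizing u with
  | zero => exact le_rfl
  | succ i ih => exact (ih _).trans (natDegree_qBackward_le i u)

/-- Summation by parts: the shift n → n + 1 moves the difference from u to φ, and the boundary term
at n = 0 contains u(1/q) = 0. -/
theorem qFunctional_qBackward_mul (hq0 : q ≠ 0) (hq : |q| ≤ 1) (hz0 : z ≠ 0) (hz : |z| < 1)
    (m : ℕ) {u φ ψ : ℝ[X]} (hu : u.eval q⁻¹ = 0)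
    (hφ : ∀ w, φ.eval w - (q ^ m)⁻¹ * φ.eval (q * w) = ψ.eval w) :
    qFunctional q z (qBackward q z m u * φ) = qFunctional q z (u * ψ) := by
  set g : ℕ → ℝ := fun n => (q ^ m * z)⁻¹ * (z ^ n * (u.eval (q⁻¹ * q ^ n) * φ.eval (q ^ n)))
    with hg
  have hsplit : ∀ n : ℕ, z ^ n * (u * φ).eval (q ^ n) -
      z ^ n * (qBackward q z m u * φ).eval (q ^ n) = g n := fun n => by
    simp only [hg, eval_mul, qBackward_eval]; ring
  have hs := summable_qFunctional hq hz (u * φ)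
  have hs1 := summable_qFunctional hq hz (qBackward q z m u * φ)
  have hgs : Summable g := (hs.sub hs1).congr hsplit
  have hgsucc : ∀ n : ℕ, g (n + 1) =
      z ^ n * (u * φ).eval (q ^ n) - z ^ n * (u * ψ).eval (q ^ n) := fun n => by
    have h1 : q⁻¹ * q ^ (n + 1) = q ^ n := by rw [pow_succ]; field_simp
    simp only [hg, eval_mul, ← hφ]
    rw [h1, pow_succ' q n, pow_succ z n, mul_inv]
    field_simp
    ring
  have h2 : ∑' n, g n = qFunctional q z (u * φ) - qFunctional q z (u * ψ) := by
    rw [hgs.tsum_eq_zero_add, tsum_congr hgsucc,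
      hs.tsum_sub (summable_qFunctional hq hz (u * ψ)), ← qFunctional, ← qFunctional]
    simp [hg, hu]
  have h3 : ∑' n, g n = qFunctional q z (u * φ) - qFunctional q z (qBackward q z m u * φ) := by
    rw [← tsum_congr hsplit, hs.tsum_sub hs1, ← qFunctional, ← qFunctional]
  linarith

theorem qFunctional_qBackward_zero (hq0 : q ≠ 0) (hq : |q| ≤ 1) (hz0 : z ≠ 0) (hz : |z| < 1)
    (m : ℕ) {u : ℝ[X]} (hu : u.eval q⁻¹ = 0) :
    qFunctional q z (qBackward q z m u * (X ^ m * newtonPoly q 0)) = 0 := by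
  rw [qFunctional_qBackward_mul hq0 hq hz0 hz m (ψ := 0) hu fun w => ?_]
  · simp [qFunctional]
  · simp only [newtonPoly_zero, mul_one, eval_pow, eval_X, mul_pow, eval_zero]
    field_simp
    ring

theorem qFunctional_qBackward_succ (hq0 : q ≠ 0) (hq : |q| ≤ 1) (hz0 : z ≠ 0) (hz : |z| < 1)
    (m d : ℕ) {u : ℝ[X]} (hu : u.eval q⁻¹ = 0) :
    qFunctional q z (qBackward q z m u * (X ^ m * newtonPoly q (d + 1))) =
      (1 - q ^ (d + 1)) * qFunctional q z (u * (X ^ (m + 1) * newtonPoly q d)) := by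
  rw [qFunctional_qBackward_mul hq0 hq hz0 hz m
    (ψ := C (1 - q ^ (d + 1)) * (X ^ (m + 1) * newtonPoly q d)) hu fun w => ?_]
  · rw [qFunctional, qFunctional, ← tsum_mul_left]
    refine tsum_congr fun n => ?_
    simp only [eval_mul, eval_C]
    ring
  · simp only [eval_mul, eval_pow, eval_X, eval_C, newtonPoly_eval_mul_left, mul_pow]
    simp only [newtonPoly_eval_succ]
    field_simp
    ring

/-- Each backward difference costs one zero, since its value at q^(-s) involves u at q^(-s) and
q^(-s-1). This is why `qWeight` carries i zeros for i differences. -/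
theorem qBackward_eval_inv_pow (m : ℕ) {i : ℕ} {u : ℝ[X]}
    (hu : ∀ s, 1 ≤ s → s ≤ i + 1 → u.eval (q⁻¹ ^ s) = 0) (s : ℕ) (h1 : 1 ≤ s) (h2 : s ≤ i) :
    (qBackward q z m u).eval (q⁻¹ ^ s) = 0 := by
  rw [qBackward_eval, ← pow_succ', hu s h1 (by omega), hu (s + 1) (by omega) (by omega)]
  simp

/-- Each summation by parts turns X^m N_{d+1} into (1 - q^(d+1)) X^(m+1) N_d, so i of them lower the
Newton index by i. -/
theorem qFunctional_qRodrigues_add (hq0 : q ≠ 0) (hq : |q| ≤ 1) (hz0 : z ≠ 0) (hz : |z| < 1)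
    (i d : ℕ) {u : ℝ[X]} (hu : ∀ s, 1 ≤ s → s ≤ i → u.eval (q⁻¹ ^ s) = 0) :
    qFunctional q z (qRodrigues q z i u * newtonPoly q (i + d)) =
      (∏ r ∈ range i, (1 - q ^ (d + 1 + r))) *
        qFunctional q z (u * (X ^ i * newtonPoly q d)) := by
  induction i generalizing u d with
  | zero => simp [qRodrigues]
  | succ i ih =>
    rw [qRodrigues, show i + 1 + d = i + (d + 1) by ring,
      ih (d + 1) (qBackward_eval_inv_pow i hu),
      qFunctional_qBackward_succ hq0 hq hz0 hz i d (by simpa using hu 1 le_rfl (by omega)),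
      prod_range_succ' _ i, ← mul_assoc]
    congr 2
    exact prod_congr rfl fun r _ => by ring

/-- After k summations by parts N_k has become a multiple of X^k, which the difference with m = k
annihilates. -/
theorem qFunctional_qRodrigues_eq_zero (hq0 : q ≠ 0) (hq : |q| ≤ 1) (hz0 : z ≠ 0) (hz : |z| < 1)
    {i k : ℕ} (hk : k < i) {u : ℝ[X]} (hu : ∀ s, 1 ≤ s → s ≤ i → u.eval (q⁻¹ ^ s) = 0) :
    qFunctional q z (qRodrigues q z i u * newtonPoly q k) = 0 := by
  induction i generalizing u with
  | zero => omega
  | succ i ih =>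
    rw [qRodrigues]
    rcases Nat.lt_succ_iff_lt_or_eq.1 hk with h | rfl
    · exact ih h (qBackward_eval_inv_pow i hu)
    · have := qFunctional_qRodrigues_add hq0 hq hz0 hz k 0 (qBackward_eval_inv_pow (z := z) k hu)
      rw [add_zero] at this
      rw [this, qFunctional_qBackward_zero hq0 hq hz0 hz k (by simpa using hu 1 le_rfl (by omega)),
        mul_zero]

theorem qWeight_eval (i : ℕ) (w : ℝ) :
    (qWeight q i).eval w = ∏ j ∈ range i, (1 - q ^ (j + 1) * w) := by
  simp [qWeight, eval_prod]

theorem qWeight_eval_pow (i n : ℕ) :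
    (qWeight q i).eval (q ^ n) = ∏ j ∈ range i, (1 - q ^ (n + 1 + j)) := by
  rw [qWeight_eval]
  exact prod_congr rfl fun j _ => by ring

theorem qWeight_eval_inv_pow (hq0 : q ≠ 0) (i s : ℕ) (h1 : 1 ≤ s) (h2 : s ≤ i) :
    (qWeight q i).eval (q⁻¹ ^ s) = 0 := by
  rw [qWeight_eval]
  refine prod_eq_zero (i := s - 1) (mem_range.2 (by omega)) ?_
  rw [Nat.sub_add_cancel h1, inv_pow, mul_inv_cancel₀ (pow_ne_zero _ hq0), sub_self]

theorem natDegree_orthPoly_le (i : ℕ) : (orthPoly q z i).natDegree ≤ i := by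
  refine (natDegree_qRodrigues_le i _).trans ((natDegree_prod_le _ _).trans ?_)
  refine (sum_le_card_nsmul _ _ 1 fun j _ => ?_).trans_eq (by simp)
  refine (natDegree_sub_le _ _).trans (max_le (by simp) ?_)
  exact (natDegree_C_mul_le _ _).trans natDegree_X_le

theorem qFunctional_orthPoly_eq_zero (hq0 : q ≠ 0) (hq : |q| ≤ 1) (hz0 : z ≠ 0) (hz : |z| < 1)
    {i k : ℕ} (hk : k < i) : qFunctional q z (orthPoly q z i * newtonPoly q k) = 0 :=
  qFunctional_qRodrigues_eq_zero hq0 hq hz0 hz hk (qWeight_eval_inv_pow hq0 i)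

theorem qFunctional_orthPoly_add (hq0 : q ≠ 0) (hq : |q| ≤ 1) (hz0 : z ≠ 0) (hz : |z| < 1)
    (i d : ℕ) : qFunctional q z (orthPoly q z i * newtonPoly q (i + d)) =
      (∏ r ∈ range i, (1 - q ^ (d + 1 + r))) *
        ∑' n : ℕ, z ^ n * ((∏ j ∈ range i, (1 - q ^ (n + 1 + j))) *
          ((q ^ n) ^ i * (newtonPoly q d).eval (q ^ n))) := by
  rw [orthPoly, qFunctional_qRodrigues_add hq0 hq hz0 hz i d (qWeight_eval_inv_pow hq0 i),
    qFunctional]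
  simp only [eval_mul, qWeight_eval_pow, eval_pow, eval_X]

theorem abs_tsum_le_of_tail {f : ℕ → ℝ} {d : ℕ} {C : ℝ} (h0 : ∀ n < d, f n = 0)
    (h : ∀ m, |f (m + d)| ≤ C * (1 / 2) ^ m) : |∑' n, f n| ≤ C * 2 := by
  have hb : HasSum (fun m : ℕ => C * (1 / 2 : ℝ) ^ m) (C * 2) := hasSum_geometric_two.mul_left C
  have hs : Summable f := (summable_nat_add_iff d).1 (Summable.of_norm_bounded hb.summable h)
  rw [← hs.sum_add_tsum_nat_add d, sum_eq_zero fun n hn => h0 n (mem_range.1 hn), zero_add]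
  exact tsum_of_norm_bounded hb fun m => (Real.norm_eq_abs _).trans_le (h m)

/-- In `qFunctional_orthPoly_add` the terms n < d vanish, which yields |z|^d and, from (q^n)^i, the
exponent id. The constant is 128 = 4 · 16 · 2. -/
theorem abs_qFunctional_orthPoly_le (hq0 : q ≠ 0) (hq : |q| ≤ 1 / 2) (hz0 : z ≠ 0)
    (hz : |z| ≤ 1 / 2) (i d : ℕ) :
    |q| ^ i.choose 2 * |qFunctional q z (orthPoly q z i * newtonPoly q (i + d))| ≤
      128 * |q| ^ (i + d).choose 2 * |z| ^ d := by
  rw [qFunctional_orthPoly_add hq0 (by linarith) hz0 (by linarith), abs_mul]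
  have h1 := abs_prod_one_sub_le_four hq d i
  have h2 : |∑' n : ℕ, z ^ n * ((∏ j ∈ range i, (1 - q ^ (n + 1 + j))) *
      ((q ^ n) ^ i * (newtonPoly q d).eval (q ^ n)))| ≤
      (16 * |q| ^ (i * d + d.choose 2) * |z| ^ d) * 2 := by
    refine abs_tsum_le_of_tail (d := d) (fun n hn => ?_) fun m => ?_
    · rw [newtonPoly_eval_pow_eq_zero hn]; ring
    · simp only [abs_mul, abs_pow]
      calc |z| ^ (m + d) * (|∏ j ∈ range i, (1 - q ^ (m + d + 1 + j))| *
            ((|q| ^ (m + d)) ^ i * |(newtonPoly q d).eval (q ^ (m + d))|))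
          ≤ (1 / 2) ^ m * |z| ^ d * (4 * ((|q| ^ d) ^ i * (4 * |q| ^ d.choose 2))) := by
            rw [pow_add]
            gcongr ?_ ^ _ * _ * (?_ * (?_ ^ _ * ?_))
            · exact abs_prod_one_sub_le_four hq _ _
            · exact pow_le_pow_of_le_one (abs_nonneg _) (by linarith) (by omega)
            · exact abs_newtonPoly_eval_le hq _ _
        _ = _ := by rw [← pow_mul, pow_add, mul_comm d i]; ring
  calc _ ≤ |q| ^ i.choose 2 * (4 * ((16 * |q| ^ (i * d + d.choose 2) * |z| ^ d) * 2)) := by gcongr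
    _ = _ := by rw [choose_two_add, pow_add, pow_add, pow_add]; ring

/-- The term n = 0 is at least 1/4 and the tail at most 8|z| ≤ 1/8; the prefactor is again at least
1/4. -/
theorem le_abs_qFunctional_orthPoly_self (hq0 : q ≠ 0) (hq : |q| ≤ 1 / 2) (hz0 : z ≠ 0)
    (hz : |z| ≤ 1 / 64) (i : ℕ) :
    1 / 32 ≤ |qFunctional q z (orthPoly q z i * newtonPoly q i)| := by
  have h := qFunctional_orthPoly_add hq0 (show |q| ≤ 1 by linarith) hz0
    (show |z| < 1 by linarith) i 0
  rw [add_zero] at h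
  rw [h, abs_mul]
  have hb : ∀ m : ℕ, |z ^ (m + 1) * ((∏ j ∈ range i, (1 - q ^ (m + 1 + 1 + j))) *
      ((q ^ (m + 1)) ^ i * (newtonPoly q 0).eval (q ^ (m + 1))))| ≤ (4 * |z|) * (1 / 2) ^ m :=
    fun m => by
    simp only [abs_mul, abs_pow, newtonPoly_zero, eval_one, abs_one]
    calc |z| ^ (m + 1) * (|∏ j ∈ range i, (1 - q ^ (m + 1 + 1 + j))| * ((|q| ^ (m + 1)) ^ i * 1))
        ≤ (1 / 2) ^ m * |z| * (4 * (1 * 1)) := by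
          rw [pow_succ]
          gcongr ?_ ^ _ * _ * (?_ * (?_ * _))
          · linarith
          · exact abs_prod_one_sub_le_four hq _ _
          · exact pow_le_one₀ (by positivity) (pow_le_one₀ (by positivity) (by linarith))
      _ = _ := by ring
  have ht := abs_tsum_le_of_tail (d := 0) (f := fun m : ℕ => z ^ (m + 1) *
    ((∏ j ∈ range i, (1 - q ^ (m + 1 + 1 + j))) *
      ((q ^ (m + 1)) ^ i * (newtonPoly q 0).eval (q ^ (m + 1))))) (by simp) hb
  have hs : Summable fun n : ℕ => z ^ n * ((∏ j ∈ range i, (1 - q ^ (n + 1 + j))) *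
      ((q ^ n) ^ i * (newtonPoly q 0).eval (q ^ n))) :=
    (summable_nat_add_iff 1).1 (Summable.of_norm_bounded (summable_geometric_two.mul_left _) hb)
  rw [hs.tsum_eq_zero_add]
  have h0 := quarter_le_abs_prod_one_sub hq 0 i
  set T := ∑' m : ℕ, z ^ (m + 1) * ((∏ j ∈ range i, (1 - q ^ (m + 1 + 1 + j))) *
      ((q ^ (m + 1)) ^ i * (newtonPoly q 0).eval (q ^ (m + 1))))
  simp only [pow_zero, one_pow, newtonPoly_zero, eval_one, mul_one, one_mul]
  have h1 := abs_sub_abs_le_abs_sub (∏ j ∈ range i, (1 - q ^ (0 + 1 + j))) (-T)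
  rw [abs_neg, sub_neg_eq_add] at h1
  have h2 : 1 / 8 ≤ |∏ j ∈ range i, (1 - q ^ (0 + 1 + j)) + T| := by linarith
  nlinarith

end Rodrigues

/-! ### Newton expansion of the kernel q^(nm) -/

section Expansion
variable {q x z : ℝ}

theorem newtonCoeff_succ_mul (hq0 : q ≠ 0) (hq : |q| < 1) (k : ℕ) :
    newtonCoeff q (k + 1) * (q ^ k * (q ^ (k + 1) - 1)) = newtonCoeff q k := by
  have h1 : 1 - q ^ (k + 1) ≠ 0 := one_sub_ne_zero_of_abs_lt_one (by
    rw [abs_pow]; exact pow_lt_one₀ (abs_nonneg _) hq (by omega))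
  have h2 : q ^ k * (q ^ (k + 1) - 1) ≠ 0 :=
    mul_ne_zero (pow_ne_zero _ hq0) (by rw [← neg_sub]; exact neg_ne_zero.2 h1)
  rw [newtonCoeff, newtonCoeff, prod_range_succ, mul_assoc, inv_mul_cancel₀ h2, mul_one]

theorem newtonCoeff_mul_eq_one (hq0 : q ≠ 0) (hq : |q| < 1) (k : ℕ) :
    |newtonCoeff q k| * |q| ^ k.choose 2 * |∏ r ∈ range k, (1 - q ^ (0 + 1 + r))| = 1 := by
  rw [← abs_pow, ← prod_range_pow_eq_choose_two, ← abs_mul, ← abs_mul, newtonCoeff,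
    ← prod_mul_distrib, ← prod_mul_distrib, abs_prod]
  refine prod_eq_one fun r _ => ?_
  have h1 : 1 - q ^ (r + 1) ≠ 0 := one_sub_ne_zero_of_abs_lt_one (by
    rw [abs_pow]; exact pow_lt_one₀ (abs_nonneg _) hq (by omega))
  have h2 : q ^ (r + 1) - 1 ≠ 0 := by rw [← neg_sub]; exact neg_ne_zero.2 h1
  have h3 : (q ^ r * (q ^ (r + 1) - 1))⁻¹ * q ^ r * (1 - q ^ (0 + 1 + r)) = -1 := by
    rw [show 0 + 1 + r = r + 1 by ring]
    field_simp
    ring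
  rw [h3]; simp

theorem abs_newtonCoeff_mul_le (hq0 : q ≠ 0) (hq : |q| ≤ 1 / 2) (k : ℕ) :
    |newtonCoeff q k| * |q| ^ k.choose 2 ≤ 4 := by
  have h1 := newtonCoeff_mul_eq_one hq0 (by linarith) k
  have h2 := quarter_le_abs_prod_one_sub hq 0 k
  have h3 : 0 ≤ |newtonCoeff q k| * |q| ^ k.choose 2 := by positivity
  nlinarith

theorem le_abs_newtonCoeff_mul (hq0 : q ≠ 0) (hq : |q| ≤ 1 / 2) (k : ℕ) :
    1 / 4 ≤ |newtonCoeff q k| * |q| ^ k.choose 2 := by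
  have h1 := newtonCoeff_mul_eq_one hq0 (by linarith) k
  have h2 := abs_prod_one_sub_le_four hq 0 k
  have h3 : 0 ≤ |newtonCoeff q k| * |q| ^ k.choose 2 := by positivity
  nlinarith

/-- Taken at w = q^n, this expands q^(nm) symmetrically in n and m. The induction multiplies by w
using w N_k = N_{k+1} + q^k N_k. -/
theorem pow_eq_sum_newton (hq0 : q ≠ 0) (hq : |q| < 1) (m : ℕ) (w : ℝ) :
    w ^ m = ∑ k ∈ range (m + 1), newtonCoeff q k * (newtonPoly q k).eval (q ^ m) *
      (newtonPoly q k).eval w := by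
  induction m with
  | zero => simp [newtonCoeff]
  | succ m ih =>
    have hw : ∀ k, w * (newtonPoly q k).eval w =
        (newtonPoly q (k + 1)).eval w + q ^ k * (newtonPoly q k).eval w := fun k => by
      rw [newtonPoly_eval_succ]; ring
    have h1 : w ^ (m + 1) = ∑ k ∈ range (m + 1),
          newtonCoeff q k * (newtonPoly q k).eval (q ^ m) * (newtonPoly q (k + 1)).eval w +
        ∑ k ∈ range (m + 2), newtonCoeff q k * (newtonPoly q k).eval (q ^ m) *
          (q ^ k * (newtonPoly q k).eval w) := by
      rw [sum_range_succ _ (m + 1), newtonPoly_eval_pow_eq_zero (Nat.lt_succ_self m), pow_succ, ih,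
        sum_mul, mul_zero, zero_mul, add_zero, ← sum_add_distrib]
      refine sum_congr rfl fun k _ => ?_
      rw [← mul_add, ← hw]; ring
    rw [h1, sum_range_succ' _ (m + 1), sum_range_succ' _ (m + 1), ← add_assoc, ← sum_add_distrib]
    congr 1
    · refine sum_congr rfl fun k _ => ?_
      rw [pow_succ' q m, newtonPoly_eval_mul_left, newtonPoly_eval_succ k (q ^ m),
        ← newtonCoeff_succ_mul hq0 hq k]
      ring
    · simp

theorem summable_qPair_newton (hq0 : q ≠ 0) (hq : |q| ≤ 1 / 2) (hx : |x| < 1) (hz : |z| < 1)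
    (P Q : ℝ[X]) :
    Summable fun a : ℕ × (ℕ × ℕ) => newtonCoeff q a.1 *
    ((z ^ a.2.1 * (P * newtonPoly q a.1).eval (q ^ a.2.1)) *
      (x ^ a.2.2 * (Q * newtonPoly q a.1).eval (q ^ a.2.2))) := by
  have hq1 : |q| ≤ 1 := by linarith
  obtain ⟨C, hC, hP⟩ := exists_abs_eval_pow_le hq1 P
  obtain ⟨D, hD, hQ⟩ := exists_abs_eval_pow_le hq1 Q
  have hg : Summable fun a : ℕ × (ℕ × ℕ) => (∏ j ∈ range a.1, (1 * |q| ^ j)) *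
      ((|z| ^ a.2.1 * |x| ^ a.2.2) * (64 * C * D)) := by
    have h1 : Summable fun a : ℕ × ℕ => (|z| ^ a.1 * |x| ^ a.2) * (64 * C * D) :=
      (Summable.mul_of_nonneg (summable_geometric_of_lt_one (abs_nonneg _) hz)
        (summable_geometric_of_lt_one (abs_nonneg _) hx) (fun _ => by positivity)
        fun _ => by positivity).mul_right _
    have h2 : Summable fun k : ℕ => ∏ j ∈ range k, (1 * |q| ^ j) :=
      summable_pow_mul_prod (abs_nonneg q) (by linarith) zero_le_one
    have h3 : ∀ a : ℕ × ℕ, 0 ≤ (|z| ^ a.1 * |x| ^ a.2) * (64 * C * D) := fun a => by positivity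
    have h4 : ∀ k : ℕ, 0 ≤ ∏ j ∈ range k, (1 * |q| ^ j) := fun k => by positivity
    exact h2.mul_of_nonneg h1 h4 h3
  refine Summable.of_norm_bounded hg ?_
  rintro ⟨k, n, m⟩
  have h4 := abs_newtonCoeff_mul_le hq0 hq k
  simp only [Real.norm_eq_abs, abs_mul, abs_pow, eval_mul, one_mul,
    prod_range_pow_eq_choose_two]
  calc |newtonCoeff q k| * (|z| ^ n * (|P.eval (q ^ n)| * |(newtonPoly q k).eval (q ^ n)|) *
        (|x| ^ m * (|Q.eval (q ^ m)| * |(newtonPoly q k).eval (q ^ m)|)))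
      ≤ |newtonCoeff q k| * (|z| ^ n * (C * (4 * |q| ^ k.choose 2)) *
        (|x| ^ m * (D * (4 * |q| ^ k.choose 2)))) := by
        gcongr
        · exact hP n
        · exact abs_newtonPoly_eval_le hq _ _
        · exact hQ m
        · exact abs_newtonPoly_eval_le hq _ _
    _ = (|newtonCoeff q k| * |q| ^ k.choose 2) *
        (|q| ^ k.choose 2 * (|z| ^ n * |x| ^ m * (16 * C * D))) := by ring
    _ ≤ 4 * (|q| ^ k.choose 2 * (|z| ^ n * |x| ^ m * (16 * C * D))) := by gcongr
    _ = _ := by ring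

theorem qPair_hasSum_newton (hq0 : q ≠ 0) (hq : |q| ≤ 1 / 2) (hx : |x| < 1) (hz : |z| < 1)
    (P Q : ℝ[X]) :
    HasSum (fun k => newtonCoeff q k * (qFunctional q z (P * newtonPoly q k) *
      qFunctional q x (Q * newtonPoly q k))) (qPair q x z P Q) := by
  have hq1 : |q| ≤ 1 := by linarith
  have hsum := summable_qPair_newton hq0 hq hx hz P Q
  set F : ℕ × (ℕ × ℕ) → ℝ := fun a => newtonCoeff q a.1 *
    ((z ^ a.2.1 * (P * newtonPoly q a.1).eval (q ^ a.2.1)) *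
      (x ^ a.2.2 * (Q * newtonPoly q a.1).eval (q ^ a.2.2))) with hF
  have hrow : ∀ a : ℕ × ℕ, HasSum (fun k => F (k, a))
      (z ^ a.1 * x ^ a.2 * q ^ (a.1 * a.2) * P.eval (q ^ a.1) * Q.eval (q ^ a.2)) := by
    rintro ⟨n, m⟩
    have h1 : HasSum (fun k => F (k, (n, m))) (∑ k ∈ range (m + 1), F (k, (n, m))) :=
      hasSum_sum_of_ne_finset_zero fun k hk => by
        simp only [hF, eval_mul]
        rw [newtonPoly_eval_pow_eq_zero (n := m) (by simpa [Nat.lt_succ_iff] using hk)]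
        simp
    have h2 : ∑ k ∈ range (m + 1), F (k, (n, m)) =
        z ^ n * x ^ m * q ^ (n * m) * P.eval (q ^ n) * Q.eval (q ^ m) := by
      -- The kernel is read as (q^n)^m; its expansion stops at k = m.
      rw [pow_mul, pow_eq_sum_newton hq0 (by linarith) m (q ^ n), mul_sum, sum_mul, sum_mul]
      refine sum_congr rfl fun k _ => ?_
      simp only [hF, eval_mul]
      ring
    rwa [h2] at h1
  have hs1 : HasSum (fun a : ℕ × ℕ => z ^ a.1 * x ^ a.2 * q ^ (a.1 * a.2) * P.eval (q ^ a.1) *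
      Q.eval (q ^ a.2)) (∑' b : (ℕ × ℕ) × ℕ, F b.swap) :=
    hsum.prod_symm.hasSum.prod_fiberwise hrow
  have hs2 : ∑' b : (ℕ × ℕ) × ℕ, F b.swap = ∑' b, F b :=
    (Equiv.prodComm (ℕ × ℕ) ℕ).tsum_eq F
  rw [qPair, hs1.tsum_eq, hs2]
  refine hsum.hasSum.prod_fiberwise fun k => ?_
  have hz' := summable_qFunctional hq1 hz (P * newtonPoly q k)
  have hx' := summable_qFunctional hq1 hx (Q * newtonPoly q k)
  exact (hz'.hasSum.mul hx'.hasSum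
    (summable_mul_of_summable_norm hz'.norm hx'.norm)).mul_left (newtonCoeff q k)

end Expansion

/-! ### Diagonal dominance and nonvanishing determinants -/

section Nonvanishing
variable {q x z : ℝ}

theorem sum_half_pow_dist_le (i N : ℕ) :
    ∑ j ∈ range N, (1 / 2 : ℝ) ^ ((i - j) + (j - i)) ≤ 3 := by
  have h1 : ∀ i : ℕ, ∑ j ∈ range (i + 1), (1 / 2 : ℝ) ^ ((i - j) + (j - i)) ≤ 2 := fun i => by
    have : ∑ j ∈ range (i + 1), (1 / 2 : ℝ) ^ ((i - j) + (j - i)) =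
        ∑ j ∈ range (i + 1), (1 / 2 : ℝ) ^ j := by
      rw [← sum_range_reflect]
      refine sum_congr rfl fun j hj => ?_
      have := mem_range.1 hj
      congr 1; omega
    rw [this]
    exact sum_geometric_two_le _
  have h2 : ∀ d : ℕ, ∑ j ∈ range (i + 1 + d), (1 / 2 : ℝ) ^ ((i - j) + (j - i)) ≤
      3 - (1 / 2) ^ d := fun d => by
    induction d with
    | zero => have := h1 i; norm_num at this ⊢; linarith
    | succ d ih =>
      rw [← add_assoc, sum_range_succ]
      have : (i - (i + 1 + d)) + (i + 1 + d - i) = d + 1 := by omega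
      rw [this, pow_succ]
      linarith
  calc _ ≤ ∑ j ∈ range (i + 1 + N), (1 / 2 : ℝ) ^ ((i - j) + (j - i)) :=
        sum_le_sum_of_subset_of_nonneg (range_mono (by omega)) fun _ _ _ => by positivity
    _ ≤ 3 - (1 / 2) ^ N := h2 N
    _ ≤ 3 := by linarith [show (0 : ℝ) ≤ (1 / 2) ^ N by positivity]

theorem abs_newton_term_le (hq0 : q ≠ 0) (hq : |q| ≤ 1 / 2) (hx0 : x ≠ 0) (hz0 : z ≠ 0)
    {η : ℝ} (hη : η ≤ 1 / 2) (hx : |x| ≤ η) (hz : |z| ≤ η) {i j k : ℕ} (hi : i ≤ k) (hj : j ≤ k) :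
    |q| ^ i.choose 2 * |q| ^ j.choose 2 * |newtonCoeff q k *
      (qFunctional q z (orthPoly q z i * newtonPoly q k) *
        qFunctional q x (orthPoly q x j * newtonPoly q k))| ≤
      2 ^ 16 * |q| ^ k.choose 2 * η ^ ((k - i) + (k - j)) := by
  obtain ⟨d, rfl⟩ := Nat.exists_eq_add_of_le hi
  obtain ⟨e, he⟩ := Nat.exists_eq_add_of_le hj
  have h1 := abs_qFunctional_orthPoly_le hq0 hq hz0 (hz.trans hη) i d
  have h2 := abs_qFunctional_orthPoly_le hq0 hq hx0 (hx.trans hη) j e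
  rw [← he] at h2
  have h3 := abs_newtonCoeff_mul_le hq0 hq (i + d)
  have hη0 : 0 ≤ η := (abs_nonneg _).trans hx
  have e1 : i + d - i = d := by omega
  have e2 : i + d - j = e := by omega
  rw [abs_mul, abs_mul, e1, e2]
  calc _ = |newtonCoeff q (i + d)| *
        ((|q| ^ i.choose 2 * |qFunctional q z (orthPoly q z i * newtonPoly q (i + d))|) *
        (|q| ^ j.choose 2 * |qFunctional q x (orthPoly q x j * newtonPoly q (i + d))|)) := by ring
    _ ≤ |newtonCoeff q (i + d)| * ((128 * |q| ^ (i + d).choose 2 * |z| ^ d) *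
        (128 * |q| ^ (i + d).choose 2 * |x| ^ e)) := by gcongr
    _ = (|newtonCoeff q (i + d)| * |q| ^ (i + d).choose 2) *
        (16384 * |q| ^ (i + d).choose 2 * (|z| ^ d * |x| ^ e)) := by ring
    _ ≤ 4 * (16384 * |q| ^ (i + d).choose 2 * (η ^ d * η ^ e)) := by gcongr
    _ = _ := by rw [pow_add]; ring

theorem pow_choose_two_anti (hq : |q| ≤ 1 / 2) {i k : ℕ} (h : i ≤ k) :
    |q| ^ k.choose 2 ≤ |q| ^ i.choose 2 :=
  pow_le_pow_of_le_one (abs_nonneg _) (by linarith) (Nat.choose_le_choose 2 h)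

/-- Orthogonality kills all k < max(i, j); at k = max(i, j) + m the exponent of η is |i - j| + 2m.
The truncated differences (i - j) + (j - i) encode |i - j|. -/
theorem abs_qPair_orthPoly_le (hq0 : q ≠ 0) (hq : |q| ≤ 1 / 2) (hx0 : x ≠ 0) (hz0 : z ≠ 0)
    {η : ℝ} (hη : η ≤ 1 / 2) (hx : |x| ≤ η) (hz : |z| ≤ η) (i j : ℕ) :
    |q| ^ i.choose 2 * |q| ^ j.choose 2 * |qPair q x z (orthPoly q z i) (orthPoly q x j)| ≤
      2 ^ 17 * |q| ^ i.choose 2 * η ^ ((i - j) + (j - i)) := by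
  have hη0 : 0 ≤ η := (abs_nonneg _).trans hx
  have hq1 : |q| ≤ 1 := by linarith
  rw [← (qPair_hasSum_newton hq0 hq (by linarith) (by linarith) _ _).tsum_eq]
  have hpos : 0 ≤ |q| ^ i.choose 2 * |q| ^ j.choose 2 := by positivity
  rw [← abs_of_nonneg hpos, ← abs_mul, ← tsum_mul_left]
  refine (abs_tsum_le_of_tail (d := max i j)
    (C := 2 ^ 16 * |q| ^ i.choose 2 * η ^ ((i - j) + (j - i))) (fun k hk => ?_)
    fun m => ?_).trans_eq (by ring)
  · rcases lt_max_iff.1 hk with h | h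
    · rw [qFunctional_orthPoly_eq_zero hq0 hq1 hz0 (by linarith) h]; ring
    · rw [qFunctional_orthPoly_eq_zero hq0 hq1 hx0 (by linarith) h]; ring
  · have hi : i ≤ m + max i j := (le_max_left i j).trans (by omega)
    have hj : j ≤ m + max i j := (le_max_right i j).trans (by omega)
    rw [abs_mul, abs_of_nonneg hpos]
    refine (abs_newton_term_le hq0 hq hx0 hz0 hη hx hz hi hj).trans ?_
    have e : (m + max i j - i) + (m + max i j - j) = (i - j) + (j - i) + m + m := by omega
    rw [e, pow_add, pow_add]
    calc _ ≤ 2 ^ 16 * |q| ^ i.choose 2 *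
          (η ^ ((i - j) + (j - i)) * (1 / 2) ^ m * 1) := by
          gcongr 2 ^ 16 * ?_ * (_ * ?_ * ?_)
          · exact pow_choose_two_anti hq hi
          · exact pow_le_pow_left₀ hη0 hη m
          · exact pow_le_one₀ hη0 (by linarith)
      _ = _ := by ring

/-- The term k = i dominates, with 1/4096 = 1/4 · (1/32)²; all later terms carry a factor η. -/
theorem le_abs_qPair_orthPoly_self (hq0 : q ≠ 0) (hq : |q| ≤ 1 / 2) (hx0 : x ≠ 0) (hz0 : z ≠ 0)
    {η : ℝ} (hη : η ≤ 1 / 64) (hx : |x| ≤ η) (hz : |z| ≤ η) (i : ℕ) :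
    |q| ^ i.choose 2 * (1 / 4096 - 2 ^ 17 * η) ≤
    |q| ^ i.choose 2 * |q| ^ i.choose 2 * |qPair q x z (orthPoly q z i) (orthPoly q x i)| := by
  have hη0 : 0 ≤ η := (abs_nonneg _).trans hx
  have hq1 : |q| ≤ 1 := by linarith
  have hH := (qPair_hasSum_newton hq0 hq (show |x| < 1 by linarith) (show |z| < 1 by linarith)
    (orthPoly q z i) (orthPoly q x i)).mul_left (|q| ^ i.choose 2 * |q| ^ i.choose 2)
  have hpos : 0 ≤ |q| ^ i.choose 2 * |q| ^ i.choose 2 := by positivity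
  rw [← abs_of_nonneg hpos, ← abs_mul, ← hH.tsum_eq, ← hH.summable.sum_add_tsum_nat_add (i + 1),
    sum_range_succ, sum_eq_zero fun k hk => by
      rw [qFunctional_orthPoly_eq_zero hq0 hq1 hz0 (by linarith) (mem_range.1 hk)]; ring, zero_add]
  have ht := abs_tsum_le_of_tail (d := 0) (C := 2 ^ 16 * |q| ^ i.choose 2 * η)
    (f := fun k => |q| ^ i.choose 2 * |q| ^ i.choose 2 * (newtonCoeff q (k + (i + 1)) *
      (qFunctional q z (orthPoly q z i * newtonPoly q (k + (i + 1))) *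
        qFunctional q x (orthPoly q x i * newtonPoly q (k + (i + 1))))))
    (by simp) fun m => by
      rw [add_zero, abs_mul, abs_of_nonneg hpos]
      refine (abs_newton_term_le hq0 hq hx0 hz0 (by linarith) hx hz (by omega) (by omega)).trans ?_
      have e : (m + (i + 1) - i) + (m + (i + 1) - i) = 1 + m + (m + 1) := by omega
      rw [e, pow_add, pow_add, pow_one]
      calc _ ≤ 2 ^ 16 * |q| ^ i.choose 2 * (η * (1 / 2) ^ m * 1) := by
            gcongr 2 ^ 16 * ?_ * (_ * ?_ * ?_)
            · exact pow_choose_two_anti hq (by omega)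
            · exact pow_le_pow_left₀ hη0 (by linarith) m
            · exact pow_le_one₀ hη0 (by linarith)
        _ = _ := by ring
  have hmain : |q| ^ i.choose 2 * (1 / 4096) ≤
      |(|q| ^ i.choose 2 * |q| ^ i.choose 2 * (newtonCoeff q i *
      (qFunctional q z (orthPoly q z i * newtonPoly q i) *
        qFunctional q x (orthPoly q x i * newtonPoly q i))))| := by
    have h1 := le_abs_qFunctional_orthPoly_self hq0 hq hz0 (hz.trans hη) i
    have h2 := le_abs_qFunctional_orthPoly_self hq0 hq hx0 (hx.trans hη) i
    have h3 := le_abs_newtonCoeff_mul hq0 hq i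
    rw [abs_mul, abs_of_nonneg hpos, abs_mul, abs_mul]
    calc _ = |q| ^ i.choose 2 * (1 / 4 * (1 / 32 * (1 / 32))) := by norm_num
      _ ≤ |q| ^ i.choose 2 * ((|newtonCoeff q i| * |q| ^ i.choose 2) *
          (|qFunctional q z (orthPoly q z i * newtonPoly q i)| *
            |qFunctional q x (orthPoly q x i * newtonPoly q i)|)) := by gcongr
      _ = _ := by ring
  refine le_trans ?_ (abs_sub_abs_le_abs_add _ _)
  linarith

/-- The moment determinants do not vanish when `x` and `z` are small. -/
theorem det_moment_ne_zero (hq0 : q ≠ 0) (hq : |q| ≤ 1 / 2) (hx0 : x ≠ 0) (hz0 : z ≠ 0)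
    (hx : |x| ≤ (1 / 2) ^ 40) (hz : |z| ≤ (1 / 2) ^ 40) (N : ℕ) :
    (Matrix.of fun r s : Fin N => qPair q x z (X ^ (r : ℕ)) (X ^ (s : ℕ))).det ≠ 0 := by
  have hη : ((1 / 2) ^ 40 : ℝ) ≤ 1 / 64 := by norm_num
  have hq' : 0 < |q| := abs_pos.2 hq0
  have h := congrArg Matrix.det (qPair_matrix_eq (q := q) (x := x) (z := z) (by linarith)
    (by linarith) (by linarith) (natDegree_orthPoly_le (q := q) (z := z))
    (natDegree_orthPoly_le (q := q) (z := x)) N)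
  rw [Matrix.det_mul, Matrix.det_mul] at h
  -- Scaling row i by |q|^(i choose 2) and column j by |q|^(j choose 2) makes all of row i
  -- comparable to |q|^(i choose 2).
  suffices hne : (Matrix.of fun i j : Fin N => |q| ^ (j : ℕ).choose 2 *
      (Matrix.of fun i j : Fin N => |q| ^ (i : ℕ).choose 2 *
        (Matrix.of fun i j : Fin N => qPair q x z (orthPoly q z i) (orthPoly q x j)) i j) i j).det
      ≠ 0 by
    intro h0
    rw [h0, mul_zero, zero_mul] at h
    apply hne
    rw [Matrix.det_mul_row, Matrix.det_mul_column, h, mul_zero, mul_zero]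
  apply det_ne_zero_of_sum_row_lt_diag
  intro i
  simp only [Matrix.of_apply, Real.norm_eq_abs]
  have e : ∀ j : Fin N, |(|q| ^ (j : ℕ).choose 2 * (|q| ^ (i : ℕ).choose 2 *
      qPair q x z (orthPoly q z i) (orthPoly q x j)))| = |q| ^ (i : ℕ).choose 2 *
      |q| ^ (j : ℕ).choose 2 * |qPair q x z (orthPoly q z i) (orthPoly q x j)| := fun j => by
    rw [abs_mul, abs_mul, abs_pow, abs_pow, abs_abs]; ring
  simp only [e]
  refine lt_of_lt_of_le ?_ (le_abs_qPair_orthPoly_self hq0 hq hx0 hz0 hη hx hz i)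
  have hδ : 0 < |q| ^ (i : ℕ).choose 2 := by positivity
  calc ∑ j ∈ univ.erase i, |q| ^ (i : ℕ).choose 2 * |q| ^ (j : ℕ).choose 2 *
        |qPair q x z (orthPoly q z i) (orthPoly q x j)|
      ≤ ∑ j ∈ univ.erase i, 2 ^ 18 * |q| ^ (i : ℕ).choose 2 * (1 / 2) ^ 40 *
        (1 / 2) ^ (((i : ℕ) - j) + (j - i)) := by
        refine sum_le_sum fun j hj => ?_
        refine (abs_qPair_orthPoly_le hq0 hq hx0 hz0 (hη.trans (by norm_num)) hx hz i j).trans ?_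
        have hij : (j : ℕ) ≠ i := fun h => (mem_erase.1 hj).1 (Fin.ext h)
        obtain ⟨d, hd⟩ : ∃ d, ((i : ℕ) - j) + (j - i) = d + 1 :=
          ⟨((i : ℕ) - j) + (j - i) - 1, by omega⟩
        rw [hd, pow_succ ((1 / 2 : ℝ) ^ 40) d, pow_succ (1 / 2 : ℝ) d]
        have : ((1 / 2 : ℝ) ^ 40) ^ d ≤ (1 / 2) ^ d := by
          -- Of η^(d+1), one factor 2^(-40) is kept for smallness and the rest is weakened to 2^(-d)
          -- for summability.
          gcongr
          norm_num
        calc _ ≤ 2 ^ 17 * |q| ^ (i : ℕ).choose 2 * ((1 / 2) ^ d * (1 / 2) ^ 40) := by gcongr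
          _ = _ := by ring
    _ ≤ ∑ j : Fin N, 2 ^ 18 * |q| ^ (i : ℕ).choose 2 * (1 / 2) ^ 40 *
        (1 / 2) ^ (((i : ℕ) - j) + (j - i)) :=
        sum_le_sum_of_subset_of_nonneg (erase_subset _ _) fun _ _ _ => by positivity
    _ ≤ 2 ^ 18 * |q| ^ (i : ℕ).choose 2 * (1 / 2) ^ 40 * 3 := by
        rw [← mul_sum, Fin.sum_univ_eq_sum_range
          (fun j => (1 / 2 : ℝ) ^ (((i : ℕ) - j) + (j - i)))]
        gcongr
        exact sum_half_pow_dist_le _ _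
    _ < |q| ^ (i : ℕ).choose 2 * (1 / 4096 - 2 ^ 17 * (1 / 2) ^ 40) := by
        rw [show 2 ^ 18 * |q| ^ (i : ℕ).choose 2 * (1 / 2) ^ 40 * 3 =
          |q| ^ (i : ℕ).choose 2 * (2 ^ 18 * (1 / 2) ^ 40 * 3) by ring]
        gcongr
        norm_num

end Nonvanishing

/-! ### Reduction to small arguments and conclusion -/

section Irrationality

theorem abs_mul_inv_pow_le {p : ℤ} (hp : 1 < |p|) {x η : ℝ} (hx : |x| < 1) {s : ℕ}
    (hs : (1 / 2 : ℝ) ^ s ≤ η) : |x * (p : ℝ)⁻¹ ^ s| ≤ η := by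
  have hp2 : (2 : ℝ) ≤ |(p : ℝ)| := by exact_mod_cast hp
  rw [abs_mul, abs_pow, abs_inv]
  calc |x| * |(p : ℝ)|⁻¹ ^ s ≤ 1 * (1 / 2) ^ s := by
        gcongr
        rw [one_div]
        exact inv_anti₀ (by norm_num) hp2
    _ ≤ η := by rwa [one_mul]

theorem irrational_lambertSum {p : ℤ} (hp : 1 < |p|) {x z : ℚ} (hx0 : x ≠ 0) (hz0 : z ≠ 0)
    (hx : |x| < 1) (hz : |z| < 1) : Irrational (lambertSum (p : ℝ)⁻¹ x z) := by
  have hp2 : (2 : ℝ) ≤ |(p : ℝ)| := by exact_mod_cast hp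
  have hp0 : (p : ℝ) ≠ 0 := abs_pos.1 (by linarith)
  have hpQ : (p : ℚ) ≠ 0 := by exact_mod_cast hp0
  have hq : |(p : ℝ)⁻¹| ≤ 1 / 2 := by
    rw [abs_inv, one_div]
    exact inv_anti₀ (by norm_num) hp2
  have hxR : |(x : ℝ)| < 1 := by exact_mod_cast hx
  have hzR : |(z : ℝ)| < 1 := by exact_mod_cast hz
  have hq1 : |(p : ℝ)⁻¹| ≤ 1 := by linarith
  have hshift : ∀ i j : ℕ, ¬ Irrational (lambertSum (p : ℝ)⁻¹ x z) →
      ¬ Irrational (lambertSum (p : ℝ)⁻¹ (x * (p : ℝ)⁻¹ ^ j) (z * (p : ℝ)⁻¹ ^ i)) := by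
    intro i j h
    simp only [Irrational, not_not, Set.mem_range] at h ⊢
    induction j with
    | zero =>
      induction i with
      | zero => simpa using h
      | succ i ih =>
        obtain ⟨t, ht⟩ := ih
        have hr := lambertSum_mul_right hq1 hxR (abs_lt_one_mul_pow hq1 hzR i)
        refine ⟨(t - (1 - z * (p : ℚ)⁻¹ ^ i)⁻¹) / x, ?_⟩
        rw [pow_zero, mul_one] at ht ⊢
        rw [← ht, mul_assoc (z : ℝ), ← pow_succ] at hr
        have : (x : ℝ) ≠ 0 := by exact_mod_cast hx0
        push_cast
        rw [← hr, mul_div_cancel_left₀ _ this]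
    | succ j ih =>
      obtain ⟨t, ht⟩ := ih
      have hr := lambertSum_mul_left hq1 (abs_lt_one_mul_pow hq1 hxR j)
        (abs_lt_one_mul_pow hq1 hzR i)
      refine ⟨(t - (1 - x * (p : ℚ)⁻¹ ^ j)⁻¹) / (z * (p : ℚ)⁻¹ ^ i), ?_⟩
      rw [← ht, mul_assoc (x : ℝ), ← pow_succ] at hr
      have : (z : ℝ) * (p : ℝ)⁻¹ ^ i ≠ 0 :=
        mul_ne_zero (by exact_mod_cast hz0) (pow_ne_zero _ (inv_ne_zero hp0))
      push_cast
      rw [← hr, mul_div_cancel_left₀ _ this]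
  by_contra hirr
  -- As |p| ≥ 2, forty shifts bring both arguments below the threshold 2^(-40) of
  -- `det_moment_ne_zero`.
  apply hshift 40 40 hirr
  set x' : ℚ := x * (p : ℚ)⁻¹ ^ 40 with hx'
  set z' : ℚ := z * (p : ℚ)⁻¹ ^ 40 with hz'
  have ex : (x : ℝ) * (p : ℝ)⁻¹ ^ 40 = (x'.num : ℝ) / (x'.den : ℤ) := by
    have : ((x' : ℚ) : ℝ) = (x'.num : ℝ) / (x'.den : ℤ) := by
      exact_mod_cast congrArg (Rat.cast (K := ℝ)) (Rat.num_div_den x').symm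
    rw [← this, hx']; push_cast; rfl
  have ez : (z : ℝ) * (p : ℝ)⁻¹ ^ 40 = (z'.num : ℝ) / (z'.den : ℤ) := by
    have : ((z' : ℚ) : ℝ) = (z'.num : ℝ) / (z'.den : ℤ) := by
      exact_mod_cast congrArg (Rat.cast (K := ℝ)) (Rat.num_div_den z').symm
    rw [← this, hz']; push_cast; rfl
  have hx1 := abs_mul_inv_pow_le hp hxR (le_refl ((1 / 2 : ℝ) ^ 40))
  have hz1 := abs_mul_inv_pow_le hp hzR (le_refl ((1 / 2 : ℝ) ^ 40))
  have hx'0 : x' ≠ 0 := mul_ne_zero hx0 (pow_ne_zero _ (inv_ne_zero hpQ))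
  have hz'0 : z' ≠ 0 := mul_ne_zero hz0 (pow_ne_zero _ (inv_ne_zero hpQ))
  have hpq : ∀ {y : ℚ}, y ≠ 0 → (y : ℝ) * (p : ℝ)⁻¹ ^ 40 ≠ 0 := fun hy =>
    mul_ne_zero (by exact_mod_cast hy) (pow_ne_zero _ (inv_ne_zero hp0))
  have hdet := det_moment_ne_zero (inv_ne_zero hp0) hq (hpq hx0) (hpq hz0) hx1 hz1
  have h40 : ((1 / 2 : ℝ)) ^ 40 ≤ 1 / 2 := by norm_num
  rw [ex] at hx1 hdet ⊢
  rw [ez] at hz1 hdet ⊢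
  exact irrational_lambertSum_of_det_ne_zero hp (Rat.num_ne_zero.2 hx'0)
    (by exact_mod_cast x'.den_ne_zero) (Rat.num_ne_zero.2 hz'0)
    (by exact_mod_cast z'.den_ne_zero) (hx1.trans h40) (hz1.trans h40) hdet

end Irrationality

end QSeries

theorem theorem2 :
    (∀ p x z : ℂ, 1 < ‖p‖ → x ≠ 0 → (∀ k : ℕ, x ≠ p ^ k) → z ≠ 0 → ‖z‖ < 1 →
      Summable (qHypTerm p x z (x * z)) ∧
      Summable (genQLogTerm p (p * x) (p * z)) ∧
      qHyp p x z (x * z) = (1 - x) * (1 - z) / (p * x * z) * genQLog p (p * x) (p * z)) ∧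
    (∀ (p : ℤ) (x z : ℚ), p ≠ 0 → p ≠ 1 → p ≠ -1 →
      0 < |x| → |x| < 1 → 0 < |z| → |z| < 1 →
      Irrational (qHyp (p : ℝ) (x : ℝ) (z : ℝ) ((x : ℝ) * (z : ℝ)))) := by
  refine ⟨fun p x z hp hx0 hx hz0 hz => ?_, fun p x z hp0 hp1 hp2 hx0 hx hz0 hz => ?_⟩
  · obtain ⟨h1, h2, h3, -⟩ := qHyp_identity hp hx0 hx hz0 hz
    exact ⟨h1, h2, h3⟩
  · have hp : 1 < |p| := by
      rcases abs_cases p with ⟨h, h'⟩ | ⟨h, h'⟩ <;> omega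
    have hpR : 1 < ‖(p : ℝ)‖ := by rw [Real.norm_eq_abs]; exact_mod_cast hp
    have hx0' : x ≠ 0 := abs_pos.1 hx0
    have hz0' : z ≠ 0 := abs_pos.1 hz0
    have hxR : ‖(x : ℝ)‖ < 1 := by rw [Real.norm_eq_abs]; exact_mod_cast hx
    have hzR : ‖(z : ℝ)‖ < 1 := by rw [Real.norm_eq_abs]; exact_mod_cast hz
    obtain ⟨-, -, -, h⟩ := qHyp_identity (x := (x : ℝ)) (z := (z : ℝ)) hpR
      (by exact_mod_cast hx0') (fun k hk => by
        rw [hk, norm_pow] at hxR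
        exact absurd hxR (not_lt.2 (one_le_pow₀ hpR.le))) (by exact_mod_cast hz0') hzR
    -- The roles are exchanged: the series ∑ z^n / (1 - x q^n) is `lambertSum` with z as first
    -- argument and x as second.
    have hirr := irrational_lambertSum hp hz0' hx0' hz hx
    rw [h, ← lambertSum]
    have hne : (1 - x) * (1 - z) ≠ 0 := by
      refine mul_ne_zero ?_ ?_
      · have := (abs_lt.1 hx).2; linarith
      · have := (abs_lt.1 hz).2; linarith
    have := hirr.ratCast_mul hne
    push_cast at this
    exact this
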